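/- **Setting.** Let $A,B,C,D,E,F$ be real matrices of compatible sizes and consider the system $x_{k+1}=Ax_k+Bu_k+Ew_k$, $y_k=Cx_k+Du_k+Fw_k$ with $x_k\in\mathbb R^{n_x}$, $u_k\in\mathbb R^{n_u}$, $y_k\in\mathbb R^{n_y}$, $w_k\in\mathbb R^{n_w}$. Assume that $(A,[B,E])$ is controllable and $(A,C)$ is observable. Let $N,T,T_{\rm ini}\in\mathbb N$, with $T_{\rm ini}$ not smaller than the lag of the system (the least $\ell$ for which $C,CA,\dots,CA^{\ell-1}$, stacked, have rank $n_x$). For a sequence $v_0,\dots,v_{T-1}$ let $\mathcal H_t(v)$ be the Hankel matrix with $t$ block rows and columns $(v_c,\dots,v_{c+t-1})$, $0\le c\le T-t$. Let $(u,w,y)_{[0,T-1]}$ be a recorded trajectory of the system such that $\mathcal H_{n_x+N+T_{\rm ini}}((u,w)_{[0,T-1]})$ has full row rank (persistency of excitation). For $v\in\{u,y,w\}$ let $\mathcal H_{v,\rm p}$ and $\mathcal H_{v,\rm f}$ consist of the first $T_{\rm ini}$ and the last $N$ block rows of $\mathcal H_{N+T_{\rm ini}}(v_{[0,T-1]})$,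 and let $\mathcal H_{\rm p},\mathcal H_{\rm f}$ be the stacked matrices for $(u,y,w)$. Let $Q\succeq0$, $R\succ0$, $\|x\|_M^2=x^\top Mx$, $a_{u,i}\in\mathbb R^{n_u}$ ($1\le i\le N_u$), $a_{y,i}\in\mathbb R^{n_y}$ ($1\le i\le N_y$), $\varepsilon_u,\varepsilon_y\in(0,1)$, $\sigma(\varepsilon)=\sqrt{(1-\varepsilon)/\varepsilon}$, $\bar m\in\mathbb R^{n_w}$, $\bar\Gamma\succ0$ in $\mathbb R^{n_w\times n_w}$, $\rho\ge0$. Let $\mathcal D(m,\Gamma)$ be the set of probability distributions on $\mathbb R^{n_w}$ with mean $m$ and covariance $\Gamma$, and let $\mathcal A$ be the union of the $\mathcal D(m,\Gamma)$ over all $m$ and all $\Gamma\succeq0$ with $$\mathbb G\big((m,\Gamma),(\bar m,\bar\Gamma)\big)=\sqrt{\|m-\bar m\|^2+\operatorname{tr}\big(\Gamma+\bar\Gamma-2(\bar\Gamma^{1/2}\Gamma\bar\Gamma^{1/2})^{1/2}\big)}\le\rho .$$ Let $(\Omega,\mathcal F,\mu)$ be a probability space that carries a uniformly distributed random variable. Let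 $\mathcal W$ be the set of sequences $W_{[0,N-1]}$ of $L^2$ random vectors on $\Omega$ whose distributions lie in $\mathcal A$ and have a common mean and a common covariance, with $W_k$ and $W_i$ uncorrelated for $k\ne i$. **Model-based problem** (initial state $x_{\rm ini}$): minimize $\alpha$ over vectors $\bar u_0,\dots,\bar u_{N-1}$, gains $K=(K_{k,i})_{0\le i<k\le N-1}$ and $\alpha\in\mathbb R$ such that for all $W\in\mathcal W$ there are $L^2$ processes $U,Y,X$ with $X_0=x_{\rm ini}$, $X_{k+1}=AX_k+BU_k+EW_k$, $Y_k=CX_k+DU_k+FW_k$, $U_k=\bar u_k+\sum_{i<k}K_{k,i}W_i$, $\sum_{k=0}^{N-1}\mathbb E[\|Y_k\|_Q^2+\|U_k\|_R^2]\le\alpha$, and, for all $k$ and $i$, $\mathbb P[a_{u,i}^\top U_k\le1]\ge1-\varepsilon_u$ and $\mathbb P[a_{y,i}^\top Y_k\le1]\ge1-\varepsilon_y$. **Data-driven problem** (initial data $(u,y,w)_{[-T_{\rm ini},-1]}$). Let $L=Nn_w+1$ and $$\mathbb A=\big\{[\mathsf w^0\,|\,\mathsf W]\in\mathbb R^{n_w\times(1+n_w)}:\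 \big\|[\mathsf w^0|\mathsf W]-[\bar m|\bar\Gamma^{1/2}]\big\|_F\le\rho,\ \bar\Gamma^{1/2}\mathsf W\succeq0\big\},$$ $$\mathbb W=\big\{[\mathbf 1_N\otimes\mathsf w^0,\ I_N\otimes\mathsf W]\in\mathbb R^{Nn_w\times L}:\ [\mathsf w^0|\mathsf W]\in\mathbb A\big\}.$$ Let $K_w$ be the strictly lower block triangular matrix with blocks $K_{k,i}$. Minimize $\alpha$ over $(\bar u,K,\alpha)$ such that for every element of $\mathbb W$, with columns $\mathsf w^0_{\rm f},\dots,\mathsf w^{L-1}_{\rm f}$, there are $\mathsf u^j_{\rm f}\in\mathbb R^{Nn_u}$, $\mathsf y^j_{\rm f}\in\mathbb R^{Nn_y}$, $\mathsf g^j$ ($0\le j\le L-1$) with $\mathcal H_{\rm p}\mathsf g^j=\delta^{0j}[u_{\rm p}^\top,y_{\rm p}^\top,w_{\rm p}^\top]^\top$ (where ${\rm p}=[-T_{\rm ini},-1]$), $\mathcal H_{\rm f}\mathsf g^j=[\mathsf u_{\rm f}^{j\top},\mathsf y_{\rm f}^{j\top},\mathsf w_{\rm f}^{j\top}]^\top$,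 $\mathsf u^0_{\rm f}=\bar u+K_w\mathsf w^0_{\rm f}$, $\mathsf u^j_{\rm f}=K_w\mathsf w^j_{\rm f}$ for $j\ge1$, $\sum_k\sum_j(\|\mathsf y^j_k\|_Q^2+\|\mathsf u^j_k\|_R^2)\le\alpha$, and, for all $k$ and $i$, $$a_{u,i}^\top\mathsf u^0_k+\sigma(\varepsilon_u)\Big(\sum_{j\ge1}(a_{u,i}^\top\mathsf u^j_k)^2\Big)^{1/2}\le1,\qquad a_{y,i}^\top\mathsf y^0_k+\sigma(\varepsilon_y)\Big(\sum_{j\ge1}(a_{y,i}^\top\mathsf y^j_k)^2\Big)^{1/2}\le1 .$$ **Theorem.** For every initial data $(u,y,w)_{[-T_{\rm ini},-1]}$ that is a trajectory of the system there is $x_{\rm ini}\in\mathbb R^{n_x}$ such that the model-based problem with initial state $x_{\rm ini}$ and the data-driven problem have the same set of minimizers $(\bar u^\star,K^\star,\alpha^\star)$. -/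

import Mathlib

open MeasureTheory ProbabilityTheory
open scoped Matrix Kronecker MatrixOrder

noncomputable section

namespace DROCP

/-! ### Linear systems and data -/

/-- The matrices of `x⁺ = A x + B u + E w`, `y = C x + D u + F w`. -/
structure LTISystem (nx nu ny nw : ℕ) where
  A : Matrix (Fin nx) (Fin nx) ℝ
  B : Matrix (Fin nx) (Fin nu) ℝ
  C : Matrix (Fin ny) (Fin nx) ℝ
  D : Matrix (Fin ny) (Fin nu) ℝ
  E : Matrix (Fin nx) (Fin nw) ℝ
  F : Matrix (Fin ny) (Fin nw) ℝ

namespace LTISystem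

variable {nx nu ny nw : ℕ} (S : LTISystem nx nu ny nw)

/-- The state update `A x + B u + E w`. -/
def next (x : Fin nx → ℝ) (u : Fin nu → ℝ) (w : Fin nw → ℝ) : Fin nx → ℝ :=
  S.A *ᵥ x + S.B *ᵥ u + S.E *ᵥ w

/-- The output `C x + D u + F w`. -/
def out (x : Fin nx → ℝ) (u : Fin nu → ℝ) (w : Fin nw → ℝ) : Fin ny → ℝ :=
  S.C *ᵥ x + S.D *ᵥ u + S.F *ᵥ w

/-- The matrix `[G, A G, …, A^{nx-1} G]` with `G = [B, E]`. -/
def controllabilityMatrix : Matrix (Fin nx) (Fin nx × (Fin nu ⊕ Fin nw)) ℝ :=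
  Matrix.of fun a p => (S.A ^ (p.1 : ℕ) * Matrix.fromCols S.B S.E) a p.2

/-- `(A, [B, E])` is a controllable pair. -/
def Controllable : Prop := S.controllabilityMatrix.rank = nx

/-- The matrix with block rows `C, C A, …, C A^{ℓ-1}`. -/
def observabilityMatrix (ℓ : ℕ) : Matrix (Fin ℓ × Fin ny) (Fin nx) ℝ :=
  Matrix.of fun p b => (S.C * S.A ^ (p.1 : ℕ)) p.2 b

/-- `(A, C)` is an observable pair. -/
def Observable : Prop := (S.observabilityMatrix nx).rank = nx

/-- The lag of an observable system: the least `ℓ` for which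
`C, C A, …, C A^{ℓ-1}` have joint rank `nx`. -/
def lag : ℕ := sInf {ℓ : ℕ | (S.observabilityMatrix ℓ).rank = nx}

/-- `(u, w, y)` is an input-disturbance-output realization of length `t`. -/
def IsTrajectory {t : ℕ} (u : Fin t → Fin nu → ℝ) (w : Fin t → Fin nw → ℝ)
    (y : Fin t → Fin ny → ℝ) : Prop :=
  ∃ x : ℕ → Fin nx → ℝ, ∀ k : Fin t,
    x (k + 1) = S.next (x k) (u k) (w k) ∧ y k = S.out (x k) (u k) (w k)

end LTISystem

/-- The Hankel matrix with `t` block rows of a signal of length `T`. -/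
def hankel {ι : Type} {T : ℕ} (t : ℕ) (v : Fin T → ι → ℝ) :
    Matrix (Fin t × ι) (Fin (T + 1 - t)) ℝ :=
  Matrix.of fun p c => v ⟨p.1 + c, by have := p.1.2; have := c.2; omega⟩ p.2

/-- Persistency of excitation of order `t`: the Hankel matrix has full row rank. -/
def PersistentlyExciting {ι : Type} [Fintype ι] {T : ℕ} (t : ℕ) (v : Fin T → ι → ℝ) : Prop :=
  (hankel t v).rank = t * Fintype.card ι

/-- The first `p` block rows of the Hankel matrix with `p + f` block rows. -/
def hankelPast {ι : Type} {T : ℕ} (p f : ℕ) (v : Fin T → ι → ℝ) :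
    Matrix (Fin p × ι) (Fin (T + 1 - (p + f))) ℝ :=
  (hankel (p + f) v).submatrix (fun r => (Fin.castAdd f r.1, r.2)) id

/-- The last `f` block rows of the Hankel matrix with `p + f` block rows. -/
def hankelFuture {ι : Type} {T : ℕ} (p f : ℕ) (v : Fin T → ι → ℝ) :
    Matrix (Fin f × ι) (Fin (T + 1 - (p + f))) ℝ :=
  (hankel (p + f) v).submatrix (fun r => (Fin.natAdd p r.1, r.2)) id

/-- The vectorization of a finite sequence of vectors. -/
def vec {ι : Type} {t : ℕ} (v : Fin t → ι → ℝ) : Fin t × ι → ℝ := fun p => v p.1 p.2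

/-- The block at time `k` of a vectorized sequence. -/
def block {ι : Type} {t : ℕ} (v : Fin t × ι → ℝ) (k : Fin t) : ι → ℝ := fun a => v (k, a)

/-! ### Gelbrich ambiguity -/

/-- `‖x‖²_M = xᵀ M x`. -/
def quad {ι : Type} [Fintype ι] (M : Matrix ι ι ℝ) (x : ι → ℝ) : ℝ := x ⬝ᵥ M *ᵥ x

/-- The Frobenius norm `√(tr (M Mᵀ))`. -/
def frobNorm {ι κ : Type} [Fintype ι] [Fintype κ] (M : Matrix ι κ ℝ) : ℝ :=
  Real.sqrt (M * Mᵀ).trace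

/-- The Gelbrich distance of the pairs `(m, Γ)` and `(m', Γ')`; `CFC.sqrt` is the
principal square root of a positive semidefinite matrix. -/
def gelbrich {n : ℕ} (m : Fin n → ℝ) (Γ : Matrix (Fin n) (Fin n) ℝ)
    (m' : Fin n → ℝ) (Γ' : Matrix (Fin n) (Fin n) ℝ) : ℝ :=
  Real.sqrt ((m - m') ⬝ᵥ (m - m') +
    (Γ + Γ' - (2 : ℝ) • CFC.sqrt (CFC.sqrt Γ' * Γ * CFC.sqrt Γ')).trace)

/-- The set `𝒟(m, Γ)` of distributions with mean `m` and covariance matrix `Γ`. -/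
def distributions {n : ℕ} (m : Fin n → ℝ) (Γ : Matrix (Fin n) (Fin n) ℝ) :
    Set (Measure (Fin n → ℝ)) :=
  {ν | IsProbabilityMeasure ν ∧ MemLp id 2 ν ∧ (∀ a, ∫ x, x a ∂ν = m a) ∧
    ∀ a b, cov[fun x => x a, fun x => x b; ν] = Γ a b}

/-- The Gelbrich ambiguity set `𝒜` with centre `(mbar, Γbar)` and radius `ρ`. -/
def ambiguitySet {n : ℕ} (mbar : Fin n → ℝ) (Γbar : Matrix (Fin n) (Fin n) ℝ) (ρ : ℝ) :
    Set (Measure (Fin n → ℝ)) :=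
  {ν | ∃ m Γ, ν ∈ distributions m Γ ∧ Γ.PosSemidef ∧ gelbrich m Γ mbar Γbar ≤ ρ}

/-- The set `𝒲` of square-integrable disturbance sequences whose members have distributions
in `𝒜` with common mean and covariance, and are pairwise uncorrelated. -/
def uncertaintySet {Ω : Type*} [MeasurableSpace Ω] (μ : Measure Ω) (N : ℕ) {n : ℕ}
    (mbar : Fin n → ℝ) (Γbar : Matrix (Fin n) (Fin n) ℝ) (ρ : ℝ) :
    Set (Fin N → Ω → Fin n → ℝ) :=
  {W | (∀ k, MemLp (W k) 2 μ) ∧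
    (∀ k, μ.map (W k) ∈ ambiguitySet mbar Γbar ρ) ∧
    (∃ m Γ, ∀ k, μ.map (W k) ∈ distributions m Γ) ∧
    ∀ k i, k ≠ i → ∀ a b, cov[fun ω => W k ω a, fun ω => W i ω b; μ] = 0}

/-- The ambiguity set `𝔸` of coefficient matrices `[w⁰ | w¹ … wⁿ]`; the column `inl ()` has
index `0`, the columns `inr i` have the indices `1, …, n`. -/
def coeffAmbiguitySet {n : ℕ} (mbar : Fin n → ℝ) (Γbar : Matrix (Fin n) (Fin n) ℝ) (ρ : ℝ) :
    Set (Matrix (Fin n) (Unit ⊕ Fin n) ℝ) :=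
  {M | frobNorm (M - Matrix.fromCols (Matrix.replicateCol Unit mbar) (CFC.sqrt Γbar)) ≤ ρ ∧
    (CFC.sqrt Γbar * M.toCols₂).PosSemidef}

/-- Indices `0, …, L - 1` of the basis `1, ξ₀¹, …, ξ₀ⁿ, …, ξ_{N-1}ⁿ`, with `L = N n + 1`;
the index `0` is `inl ()`. -/
abbrev PCEIndex (N n : ℕ) : Type := Unit ⊕ (Fin N × Fin n)

/-- The uncertainty set `𝕎`: the matrices `[1_N ⊗ w⁰, I_N ⊗ [w¹ … wⁿ]]` for
`[w⁰ | w¹ … wⁿ]` in `𝔸`. -/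
def coeffUncertaintySet (N : ℕ) {n : ℕ} (mbar : Fin n → ℝ)
    (Γbar : Matrix (Fin n) (Fin n) ℝ) (ρ : ℝ) :
    Set (Matrix (Fin N × Fin n) (PCEIndex N n) ℝ) :=
  {V | ∃ M ∈ coeffAmbiguitySet mbar Γbar ρ,
    V = Matrix.fromCols (Matrix.of fun p u => M.toCols₁ p.2 u)
      ((1 : Matrix (Fin N) (Fin N) ℝ) ⊗ₖ M.toCols₂)}

/-! ### The two optimal control problems -/

/-- The decisions `(ū, K, α)`, with feedback gains `K k i` for `i < k < N`. -/
abbrev Decision (N nu nw : ℕ) : Type :=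
  (Fin N → Fin nu → ℝ) × ((k : Fin N) → Fin k.val → Matrix (Fin nu) (Fin nw) ℝ) × ℝ

/-- The strictly lower block triangular matrix `K_w` of the feedback gains. -/
def gainMatrix {N nu nw : ℕ} (K : (k : Fin N) → Fin k.val → Matrix (Fin nu) (Fin nw) ℝ) :
    Matrix (Fin N × Fin nu) (Fin N × Fin nw) ℝ :=
  Matrix.of fun p q => if h : q.1.val < p.1.val then K p.1 ⟨q.1.val, h⟩ p.2 q.2 else 0

/-- Weights, half-spaces and risk levels of the chance constraints, and centre and radius of
the ambiguity set. -/
structure OCPData (nu ny nw Nu Ny : ℕ) where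
  Q : Matrix (Fin ny) (Fin ny) ℝ
  R : Matrix (Fin nu) (Fin nu) ℝ
  au : Fin Nu → Fin nu → ℝ
  ay : Fin Ny → Fin ny → ℝ
  εu : ℝ
  εy : ℝ
  mbar : Fin nw → ℝ
  Γbar : Matrix (Fin nw) (Fin nw) ℝ
  ρ : ℝ

variable {nx nu ny nw Nu Ny : ℕ}

/-- Feasible decisions of the model-based problem with initial state `xini`. -/
def modelFeasible {Ω : Type*} [MeasurableSpace Ω] (μ : Measure Ω)
    (S : LTISystem nx nu ny nw) (P : OCPData nu ny nw Nu Ny) (N : ℕ) (xini : Fin nx → ℝ) :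
    Set (Decision N nu nw) :=
  {z | ∀ W ∈ uncertaintySet μ N P.mbar P.Γbar P.ρ,
    ∃ (U : Fin N → Ω → Fin nu → ℝ) (Y : Fin N → Ω → Fin ny → ℝ)
      (X : Fin (N + 1) → Ω → Fin nx → ℝ),
      (∀ k, MemLp (U k) 2 μ) ∧ (∀ k, MemLp (Y k) 2 μ) ∧ (∀ k, MemLp (X k) 2 μ) ∧
      ∑ k, ∫ ω, (quad P.Q (Y k ω) + quad P.R (U k ω)) ∂μ ≤ z.2.2 ∧
      (∀ ω, X 0 ω = xini) ∧
      (∀ k : Fin N, ∀ ω, X k.succ ω = S.next (X k.castSucc ω) (U k ω) (W k ω)) ∧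
      (∀ k : Fin N, ∀ ω, Y k ω = S.out (X k.castSucc ω) (U k ω) (W k ω)) ∧
      (∀ k : Fin N, ∀ ω, U k ω =
        z.1 k + ∑ i : Fin k.val, z.2.1 k i *ᵥ W ⟨i.val, i.isLt.trans k.isLt⟩ ω) ∧
      (∀ k i, 1 - P.εu ≤ μ.real {ω | P.au i ⬝ᵥ U k ω ≤ 1}) ∧
      (∀ k i, 1 - P.εy ≤ μ.real {ω | P.ay i ⬝ᵥ Y k ω ≤ 1})}

/-- `σ(ε) = √((1 - ε) / ε)`. -/
def sigma (ε : ℝ) : ℝ := Real.sqrt ((1 - ε) / ε)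

/-- Feasible decisions of the data-driven problem with recorded data `(ud, wd, yd)` and initial
data `(up, yp, wp)`, in which position `i` stands for time `i - Tini`. -/
def dataFeasible {T Tini : ℕ} (ud : Fin T → Fin nu → ℝ) (wd : Fin T → Fin nw → ℝ)
    (yd : Fin T → Fin ny → ℝ) (up : Fin Tini → Fin nu → ℝ) (yp : Fin Tini → Fin ny → ℝ)
    (wp : Fin Tini → Fin nw → ℝ) (P : OCPData nu ny nw Nu Ny) (N : ℕ) :
    Set (Decision N nu nw) :=
  {z | ∀ Wf ∈ coeffUncertaintySet N P.mbar P.Γbar P.ρ,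
    ∃ (u : PCEIndex N nw → Fin N × Fin nu → ℝ) (y : PCEIndex N nw → Fin N × Fin ny → ℝ)
      (g : PCEIndex N nw → Fin (T + 1 - (Tini + N)) → ℝ),
      ∑ k, ∑ j, (quad P.Q (block (y j) k) + quad P.R (block (u j) k)) ≤ z.2.2 ∧
      (∀ j, hankelPast Tini N ud *ᵥ g j = if j = Sum.inl () then vec up else 0) ∧
      (∀ j, hankelPast Tini N yd *ᵥ g j = if j = Sum.inl () then vec yp else 0) ∧
      (∀ j, hankelPast Tini N wd *ᵥ g j = if j = Sum.inl () then vec wp else 0) ∧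
      (∀ j, hankelFuture Tini N ud *ᵥ g j = u j) ∧
      (∀ j, hankelFuture Tini N yd *ᵥ g j = y j) ∧
      (∀ j, hankelFuture Tini N wd *ᵥ g j = Wf.col j) ∧
      u (Sum.inl ()) = vec z.1 + gainMatrix z.2.1 *ᵥ Wf.col (Sum.inl ()) ∧
      (∀ q, u (Sum.inr q) = gainMatrix z.2.1 *ᵥ Wf.col (Sum.inr q)) ∧
      (∀ k i, P.au i ⬝ᵥ block (u (Sum.inl ())) k +
        sigma P.εu * Real.sqrt (∑ q, (P.au i ⬝ᵥ block (u (Sum.inr q)) k) ^ 2) ≤ 1) ∧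
      (∀ k i, P.ay i ⬝ᵥ block (y (Sum.inl ())) k +
        sigma P.εy * Real.sqrt (∑ q, (P.ay i ⬝ᵥ block (y (Sum.inr q)) k) ^ 2) ≤ 1)}

/-- The feasible decisions `(ū, K, α)` with the least `α`. -/
def minimizers {N : ℕ} (s : Set (Decision N nu nw)) : Set (Decision N nu nw) :=
  {z | z ∈ s ∧ IsMinOn (fun z' => z'.2.2) s z}

end DROCP

end

noncomputable section

namespace DROCP

/-! ### Left kernels of Hankel matrices -/

section LeftKernel

variable {n : ℕ} {κ : Type*} [Fintype κ]

/-! Both problems share the same feasible set, so their minimizers agree. With `xini` the state in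
which the initial data end, inputs and outputs are affine functions of the disturbance, and each
problem constrains this one closed-loop response: for random disturbances in the first, for
coefficient columns in the second.

On the data side the bridge is Willems' fundamental lemma. Persistency of excitation and
controllability make recorded states stacked on recorded input windows a matrix without left kernel
(`left_kernel_eq_zero`, by Cayley–Hamilton), so every trajectory is a combination of recorded
windows. A past at least as long as the lag fixes the state at time 0: column 0 continues from
`xini`, and the other columns, whose past is zero, continue from the origin
(`mem_dataFeasible_iff`).

On the stochastic side the cost depends only on mean and covariance, and the columns of `[1 ⊗ m, I ⊗
V]` encode these through `Γ = V Vᵀ`. A chance constraint that must hold for all disturbances with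
given moments is equivalent to its second-order cone form: Cantelli's inequality gives sufficiency,
and an explicit extremal disturbance built from the uniform variable gives necessity
(`chance_constraint_iff`). The Gelbrich ball matches the Frobenius ball `𝔸` because each covariance
has a factor `V` with `Γbar^{1/2} V` positive semidefinite, and for such factors the two distances
coincide (`frobNorm_eq_gelbrich`). -/

theorem dotProduct_state_add {A : Matrix (Fin n) (Fin n) ℝ} {G : Matrix (Fin n) κ ℝ} {M : ℕ}
    {x : ℕ → Fin n → ℝ} {v : ℕ → κ → ℝ} (hx : ∀ k < M, x (k + 1) = A *ᵥ x k + G *ᵥ v k)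
    (c j : ℕ) (hj : c + j ≤ M) (ξ : Fin n → ℝ) :
    ξ ⬝ᵥ x (c + j) = (ξ ᵥ* A ^ j) ⬝ᵥ x c +
      ∑ r ∈ Finset.range j, (ξ ᵥ* (A ^ (j - 1 - r) * G)) ⬝ᵥ v (c + r) := by
  induction j generalizing ξ with
  | zero => simp
  | succ j ih =>
    have h1 : ξ ⬝ᵥ x (c + (j + 1)) = (ξ ᵥ* A) ⬝ᵥ x (c + j) + (ξ ᵥ* G) ⬝ᵥ v (c + j) := by
      rw [← add_assoc, hx _ (by omega), dotProduct_add, Matrix.dotProduct_mulVec,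
        Matrix.dotProduct_mulVec]
    rw [h1, ih (by omega), Finset.sum_range_succ, Matrix.vecMul_vecMul, ← pow_succ', add_assoc]
    congr 2
    · refine Finset.sum_congr rfl fun r hr => ?_
      have hr := Finset.mem_range.1 hr
      rw [Matrix.vecMul_vecMul, ← Matrix.mul_assoc, ← pow_succ']
      congr 5
      omega
    · simp

/-- The coefficients at `v c, v (c + 1), …` of the functional `ξ ⬝ᵥ x (c + j) + ∑ η i ⬝ᵥ v (c + j + i)`
along solutions of `x⁺ = A x + G v`. -/
def shiftCoeff (A : Matrix (Fin n) (Fin n) ℝ) (G : Matrix (Fin n) κ ℝ) (ξ : Fin n → ℝ)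
    (η : ℕ → κ → ℝ) (j r : ℕ) : κ → ℝ :=
  if r < j then ξ ᵥ* (A ^ (j - 1 - r) * G) else η (r - j)

/-- A window of length `m + L` accommodates every shift `j ≤ m`, so functionals with different
shifts can be added coefficient by coefficient. -/
theorem sum_shiftCoeff (A : Matrix (Fin n) (Fin n) ℝ) (G : Matrix (Fin n) κ ℝ) (ξ : Fin n → ℝ)
    {η : ℕ → κ → ℝ} {L : ℕ} (hη : ∀ i, L ≤ i → η i = 0) (v : ℕ → κ → ℝ) (c : ℕ) {j m : ℕ}
    (hj : j ≤ m) :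
    ∑ r ∈ Finset.range (m + L), shiftCoeff A G ξ η j r ⬝ᵥ v (c + r) =
      ∑ r ∈ Finset.range j, (ξ ᵥ* (A ^ (j - 1 - r) * G)) ⬝ᵥ v (c + r) +
        ∑ i ∈ Finset.range L, η i ⬝ᵥ v (c + j + i) := by
  obtain ⟨d, rfl⟩ := Nat.exists_eq_add_of_le hj
  rw [show j + d + L = j + (L + d) by omega, Finset.sum_range_add, Finset.sum_range_add]
  congr 1
  · refine Finset.sum_congr rfl fun r hr => ?_
    rw [shiftCoeff, if_pos (Finset.mem_range.1 hr)]
  · rw [Finset.sum_eq_zero (s := Finset.range d), add_zero]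
    · refine Finset.sum_congr rfl fun r hr => ?_
      rw [shiftCoeff, if_neg (by omega), add_assoc]
      simp
    · intro r _
      rw [shiftCoeff, if_neg (by omega), hη _ (by omega), zero_dotProduct]

/-- Shifting the annihilating functional by `j = 0, …, n` and weighting with the coefficients of the
characteristic polynomial removes the state by Cayley–Hamilton. What remains annihilates all input
windows of length `n + L`, so excitation forces its coefficients to vanish. As the polynomial is
monic, these equations are triangular: they give `η = 0`, then `ξ Aᵏ G = 0` for `k < n`, and
controllability concludes. -/
theorem left_kernel_eq_zero {A : Matrix (Fin n) (Fin n) ℝ} {G : Matrix (Fin n) κ ℝ} {T L : ℕ}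
    {x : ℕ → Fin n → ℝ} {v : ℕ → κ → ℝ} (hx : ∀ k < T, x (k + 1) = A *ᵥ x k + G *ᵥ v k)
    (hctrl : ∀ ξ : Fin n → ℝ, (∀ k < n, ξ ᵥ* (A ^ k * G) = 0) → ξ = 0)
    (hpe : ∀ θ : ℕ → κ → ℝ, (∀ c, c + (n + L) ≤ T →
      ∑ r ∈ Finset.range (n + L), θ r ⬝ᵥ v (c + r) = 0) → ∀ r < n + L, θ r = 0)
    {ξ : Fin n → ℝ} {η : ℕ → κ → ℝ} (hη : ∀ i, L ≤ i → η i = 0)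
    (hker : ∀ c, c + L ≤ T →
      ξ ⬝ᵥ x c + ∑ i ∈ Finset.range L, η i ⬝ᵥ v (c + i) = 0) :
    ξ = 0 ∧ ∀ i, η i = 0 := by
  set p := A.charpoly with hp
  have hdeg : p.natDegree = n := by simp [hp, Matrix.charpoly_natDegree_eq_dim]
  have hlead : p.coeff n = 1 := by
    have := A.charpoly_monic.coeff_natDegree
    rwa [← hp, hdeg] at this
  have hCH : ∑ j ∈ Finset.range (n + 1), p.coeff j • A ^ j = 0 := by
    have := A.aeval_self_charpoly
    rwa [Polynomial.aeval_eq_sum_range, ← hp, hdeg] at this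
  have hθ : ∀ r < n + L,
      ∑ j ∈ Finset.range (n + 1), p.coeff j • shiftCoeff A G ξ η j r = 0 := by
    refine hpe (fun r => ∑ j ∈ Finset.range (n + 1), p.coeff j • shiftCoeff A G ξ η j r)
      fun c hc => ?_
    have h1 : ∀ j ∈ Finset.range (n + 1),
        ∑ r ∈ Finset.range (n + L), shiftCoeff A G ξ η j r ⬝ᵥ v (c + r) =
          - ((ξ ᵥ* A ^ j) ⬝ᵥ x c) := by
      intro j hj
      have hj := Finset.mem_range.1 hj
      have h2 := hker (c + j) (by omega)
      rw [dotProduct_state_add hx c j (by omega)] at h2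
      rw [sum_shiftCoeff A G ξ hη v c (by omega : j ≤ n)]
      linarith
    calc ∑ r ∈ Finset.range (n + L),
          (∑ j ∈ Finset.range (n + 1), p.coeff j • shiftCoeff A G ξ η j r) ⬝ᵥ v (c + r)
        = ∑ j ∈ Finset.range (n + 1), p.coeff j *
            ∑ r ∈ Finset.range (n + L), shiftCoeff A G ξ η j r ⬝ᵥ v (c + r) := by
          simp_rw [sum_dotProduct, smul_dotProduct, Finset.mul_sum]
          rw [Finset.sum_comm]
          rfl
      _ = - ((ξ ᵥ* (∑ j ∈ Finset.range (n + 1), p.coeff j • A ^ j)) ⬝ᵥ x c) := by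
          rw [Finset.sum_congr rfl fun j hj => by rw [h1 j hj]]
          rw [Matrix.vecMul_sum, sum_dotProduct, ← Finset.sum_neg_distrib]
          refine Finset.sum_congr rfl fun j _ => ?_
          rw [Matrix.vecMul_smul, smul_dotProduct, smul_eq_mul, mul_neg]
      _ = 0 := by rw [hCH]; simp
  -- Descending induction on the index: coefficient `n + i` is `η i` plus multiples of `η (n + i -
  -- j)` with `j < n`, whose indices exceed `i`.
  have hη0 : ∀ m i, L ≤ i + m → η i = 0 := by
    intro m
    induction m with
    | zero => exact fun i hi => hη i hi
    | succ m ih =>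
      intro i hi
      rcases Nat.lt_or_ge (i + m) L with h | h
      · have h2 := hθ (n + i) (by omega)
        rw [Finset.sum_range_succ, Finset.sum_eq_zero, zero_add, hlead, one_smul, shiftCoeff,
          if_neg (by omega), Nat.add_sub_cancel_left] at h2
        · exact h2
        · intro j hj
          have hj := Finset.mem_range.1 hj
          rw [shiftCoeff, if_neg (by omega), ih _ (by omega), smul_zero]
      · exact ih i h
  have hη' : ∀ i, η i = 0 := fun i => hη0 L i (by omega)
  refine ⟨hctrl ξ fun k => ?_, hη'⟩
  induction k using Nat.strong_induction_on with
  | _ k ih =>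
    intro hk
    -- Once `η = 0`, coefficient `n - 1 - k` is `ξ Aᵏ G` plus multiples of `ξ Aⁱ G` with `i < k`.
    have h2 := hθ (n - 1 - k) (by omega)
    rw [Finset.sum_range_succ, Finset.sum_eq_zero, zero_add, hlead, one_smul, shiftCoeff,
      if_pos (by omega), show n - 1 - (n - 1 - k) = k by omega] at h2
    · exact h2
    · intro j hj
      have hj := Finset.mem_range.1 hj
      rw [shiftCoeff]
      split_ifs with h
      · rw [ih _ (by omega) (by omega), smul_zero]
      · rw [hη', smul_zero]

end LeftKernel

/-! ### Full rank and trivial kernels -/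

theorem eq_zero_of_vecMul_eq_zero_of_rank {m k : Type*} [Fintype m] [Fintype k] {M : Matrix m k ℝ}
    (h : M.rank = Fintype.card m) {η : m → ℝ} (hη : η ᵥ* M = 0) : η = 0 := by
  have h1 : LinearIndependent ℝ M.row := by
    rw [linearIndependent_iff_card_eq_finrank_span, Set.finrank, ← h,
      M.rank_eq_finrank_span_row]
  exact Matrix.vecMul_injective_iff.2 h1 (by simpa using hη)

theorem eq_zero_of_mulVec_eq_zero_of_rank {m k : Type*} [Fintype m] [Fintype k] {M : Matrix m k ℝ}
    (h : M.rank = Fintype.card k) {z : k → ℝ} (hz : M *ᵥ z = 0) : z = 0 :=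
  eq_zero_of_vecMul_eq_zero_of_rank (M := Mᵀ) (by rw [Matrix.rank_transpose, h])
    (by rw [Matrix.vecMul_transpose, hz])

theorem mulVec_surjective_of_left_kernel {m k : Type*} [Fintype m] [Fintype k]
    {M : Matrix m k ℝ} (h : ∀ η : m → ℝ, η ᵥ* M = 0 → η = 0) :
    Function.Surjective M.mulVec := by
  classical
  have h1 : LinearIndependent ℝ M.row := by
    rw [← Matrix.vecMul_injective_iff]
    intro a b hab
    have := h (a - b) (by simpa [Matrix.sub_vecMul, sub_eq_zero] using hab)
    exact sub_eq_zero.1 this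
  have h2 : M.rank = Fintype.card m := h1.rank_matrix
  have h3 : LinearMap.range M.mulVecLin = ⊤ := by
    apply Submodule.eq_top_of_finrank_eq
    rw [Module.finrank_fintype_fun_eq_card, ← h2, Matrix.rank]
  exact LinearMap.range_eq_top.1 h3

/-! ### Trajectories and data -/

namespace LTISystem

variable {nx nu ny nw : ℕ} (S : LTISystem nx nu ny nw)

theorem eq_zero_of_vecMul_controllability (h : S.Controllable) {ξ : Fin nx → ℝ}
    (hξ : ∀ k < nx, ξ ᵥ* (S.A ^ k * Matrix.fromCols S.B S.E) = 0) : ξ = 0 := by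
  refine eq_zero_of_vecMul_eq_zero_of_rank (M := S.controllabilityMatrix) (h.trans (by simp)) ?_
  ext p
  exact congrFun (hξ p.1 p.1.2) p.2

theorem eq_zero_of_output_eq_zero (h : S.Observable) {t : ℕ} (ht : S.lag ≤ t) {x : Fin nx → ℝ}
    (hx : ∀ k < t, S.C *ᵥ (S.A ^ k *ᵥ x) = 0) : x = 0 := by
  -- Observability makes the set nonempty, so the infimum that defines the lag is attained.
  have h1 : S.lag ∈ {ℓ : ℕ | (S.observabilityMatrix ℓ).rank = nx} := Nat.sInf_mem ⟨nx, h⟩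
  refine eq_zero_of_mulVec_eq_zero_of_rank (M := S.observabilityMatrix S.lag) (by simpa using h1) ?_
  ext p
  have := congrFun (hx p.1 (p.1.2.trans_le ht)) p.2
  rw [Matrix.mulVec_mulVec] at this
  exact this

/-- `(u, w, y)` is a realization of length `t` whose state starts in `x₀` and ends in `x₁`. -/
def Steers {t : ℕ} (x₀ x₁ : Fin nx → ℝ) (u : Fin t → Fin nu → ℝ) (w : Fin t → Fin nw → ℝ)
    (y : Fin t → Fin ny → ℝ) : Prop :=
  ∃ x : ℕ → Fin nx → ℝ, x 0 = x₀ ∧ x t = x₁ ∧ ∀ k : Fin t,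
    x (k + 1) = S.next (x k) (u k) (w k) ∧ y k = S.out (x k) (u k) (w k)

/-- The difference of two state sequences with the same data evolves by `A` alone and has zero
output, so over at least `S.lag` steps its initial value must vanish. -/
theorem state_unique {t : ℕ} (hobs : S.Observable) (ht : S.lag ≤ t) {x x' : ℕ → Fin nx → ℝ}
    {u : Fin t → Fin nu → ℝ} {w : Fin t → Fin nw → ℝ} {y : Fin t → Fin ny → ℝ}
    (hx : ∀ k : Fin t, x (k + 1) = S.next (x k) (u k) (w k) ∧ y k = S.out (x k) (u k) (w k))
    (hx' : ∀ k : Fin t,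
      x' (k + 1) = S.next (x' k) (u k) (w k) ∧ y k = S.out (x' k) (u k) (w k)) :
    ∀ k ≤ t, x k = x' k := by
  have h1 : ∀ k ≤ t, x k - x' k = S.A ^ k *ᵥ (x 0 - x' 0) := by
    intro k
    induction k with
    | zero => simp
    | succ k ih =>
      intro hk
      have := (hx ⟨k, hk⟩).1
      have h' := (hx' ⟨k, hk⟩).1
      simp only [next] at this h'
      rw [this, h', pow_succ', ← Matrix.mulVec_mulVec, ← ih (by omega), Matrix.mulVec_sub]
      abel
  have h2 : x 0 - x' 0 = 0 := by
    refine S.eq_zero_of_output_eq_zero hobs ht fun k hk => ?_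
    rw [← h1 k hk.le, Matrix.mulVec_sub]
    have := (hx ⟨k, hk⟩).2.symm.trans (hx' ⟨k, hk⟩).2
    simp only [out] at this
    simpa [sub_eq_zero] using this
  intro k hk
  rw [← sub_eq_zero, h1 k hk, h2, Matrix.mulVec_zero]

end LTISystem

/-- A window combination of the columns of a Hankel matrix, as a sequence. -/
theorem block_hankel_mulVec {ι : Type} {T t : ℕ} (v : Fin T → ι → ℝ)
    (g : Fin (T + 1 - t) → ℝ) (k : Fin t) :
    block (hankel t v *ᵥ g) k =
      ∑ c, g c • v ⟨k + c, by have := k.2; have := c.2; omega⟩ := by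
  ext a
  simp [block, hankel, Matrix.mulVec, dotProduct, mul_comm]

theorem vecMul_hankel {ι : Type} [Fintype ι] {T t : ℕ} (v : Fin T → ι → ℝ)
    (ζ : Fin t × ι → ℝ) (c : Fin (T + 1 - t)) :
    (ζ ᵥ* hankel t v) c =
      ∑ r : Fin t, (fun q => ζ (r, q)) ⬝ᵥ
        v ⟨c + r, by have := r.2; have := c.2; omega⟩ := by
  simp only [Matrix.vecMul, dotProduct, Fintype.sum_prod_type, hankel, Matrix.of_apply,
    add_comm (c : ℕ)]

variable {nx nu ny nw : ℕ} {S : LTISystem nx nu ny nw}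

/-- Each recorded window is a trajectory and the system is linear; the matching combination of
recorded states serves as the state. -/
theorem LTISystem.next_out_hankel_mulVec {T t : ℕ} {ud : Fin T → Fin nu → ℝ}
    {wd : Fin T → Fin nw → ℝ} {yd : Fin T → Fin ny → ℝ} {x : ℕ → Fin nx → ℝ}
    (hx : ∀ k : Fin T,
      x (k + 1) = S.next (x k) (ud k) (wd k) ∧ yd k = S.out (x k) (ud k) (wd k))
    (g : Fin (T + 1 - t) → ℝ) (k : Fin t) :
    (∑ c, g c • x (k + 1 + c) = S.next (∑ c, g c • x (k + c)) (block (hankel t ud *ᵥ g) k)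
      (block (hankel t wd *ᵥ g) k)) ∧
    block (hankel t yd *ᵥ g) k = S.out (∑ c, g c • x (k + c)) (block (hankel t ud *ᵥ g) k)
      (block (hankel t wd *ᵥ g) k) := by
  simp only [block_hankel_mulVec, LTISystem.next, LTISystem.out, Matrix.mulVec_sum,
    ← Finset.sum_add_distrib, Matrix.mulVec_smul, ← smul_add]
  constructor
  · refine Finset.sum_congr rfl fun c _ => ?_
    have := (hx ⟨k + c, by have := k.2; have := c.2; omega⟩).1
    rw [show (k : ℕ) + 1 + c = k + c + 1 by omega, this]
    rfl
  · refine Finset.sum_congr rfl fun c _ => ?_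
    rw [(hx ⟨k + c, by have := k.2; have := c.2; omega⟩).2]
    rfl

/-- Under controllability and persistency of excitation of order `nx + t`, initial states and
inputs of length `t` are combinations of recorded windows. -/
theorem exists_hankel_state_eq {T t : ℕ} (hcontr : S.Controllable) {ud : Fin T → Fin nu → ℝ}
    {wd : Fin T → Fin nw → ℝ} {x : ℕ → Fin nx → ℝ}
    (hx : ∀ k : Fin T, x (k + 1) = S.next (x k) (ud k) (wd k))
    (hpe : PersistentlyExciting (nx + t) fun k => Sum.elim (ud k) (wd k))
    (x₀ : Fin nx → ℝ) (u : Fin t → Fin nu → ℝ) (w : Fin t → Fin nw → ℝ) :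
    ∃ g : Fin (T + 1 - t) → ℝ, ∑ c, g c • x c = x₀ ∧ hankel t ud *ᵥ g = vec u ∧
      hankel t wd *ᵥ g = vec w := by
  set vd : Fin T → Fin nu ⊕ Fin nw → ℝ := fun k => Sum.elim (ud k) (wd k) with hvd
  set v : ℕ → Fin nu ⊕ Fin nw → ℝ := fun k => if h : k < T then vd ⟨k, h⟩ else 0 with hv
  have hv' : ∀ k (h : k < T), v k = vd ⟨k, h⟩ := fun k h => dif_pos h
  have hx' : ∀ k < T, x (k + 1) = S.A *ᵥ x k + Matrix.fromCols S.B S.E *ᵥ v k := by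
    intro k hk
    rw [hx ⟨k, hk⟩, hv' k hk, hvd, LTISystem.next]
    simp [Matrix.fromCols_mulVec, add_assoc]
  -- Hitting any prescribed pair of initial state and input window means surjectivity of this
  -- stacked matrix, hence triviality of its left kernel.
  let M : Matrix (Fin nx ⊕ Fin t × (Fin nu ⊕ Fin nw)) (Fin (T + 1 - t)) ℝ :=
    Matrix.fromRows (Matrix.of fun a c => x c a) (hankel t vd)
  have hM : ∀ ζ, ζ ᵥ* M = 0 → ζ = 0 := by
    intro ζ hζ
    let η : ℕ → Fin nu ⊕ Fin nw → ℝ := fun i =>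
      if h : i < t then fun q => ζ (Sum.inr (⟨i, h⟩, q)) else 0
    have hη : ∀ i (h : i < t), η i = fun q => ζ (Sum.inr (⟨i, h⟩, q)) := fun i h => dif_pos h
    obtain ⟨h1, h2⟩ := left_kernel_eq_zero (L := t) (η := η) (ξ := fun a => ζ (Sum.inl a)) hx'
      (fun ξ => S.eq_zero_of_vecMul_controllability hcontr) (fun θ hθ => by
        have h0 : (fun p : Fin (nx + t) × (Fin nu ⊕ Fin nw) => θ p.1 p.2) = 0 := by
          refine eq_zero_of_vecMul_eq_zero_of_rank (M := hankel (nx + t) vd) (hpe.trans (by simp)) ?_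
          ext c
          have h3 := hθ c (by have := c.2; omega)
          rw [← Fin.sum_univ_eq_sum_range (fun r => θ r ⬝ᵥ v (c + r))] at h3
          rw [Pi.zero_apply, ← h3, vecMul_hankel]
          refine Finset.sum_congr rfl fun r _ => ?_
          rw [hv' _ (by have := c.2; have := r.2; omega)]
        intro r hr
        ext q
        exact congrFun h0 (⟨r, hr⟩, q)) (fun i hi => dif_neg (by omega)) (fun c hc => by
        have h3 := congrFun hζ ⟨c, by omega⟩
        rw [← Fin.sum_univ_eq_sum_range (fun r => η r ⬝ᵥ v (c + r))]
        rw [Matrix.vecMul_fromRows, Pi.add_apply, vecMul_hankel, Pi.zero_apply] at h3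
        rw [← h3]
        refine congrArg₂ _ rfl (Finset.sum_congr rfl fun r _ => ?_)
        rw [hv' _ (by have := r.2; omega), hη _ r.2]
        rfl)
    ext (a | ⟨i, q⟩)
    · exact congrFun h1 a
    · have := congrFun (h2 i) q
      rwa [hη _ i.2] at this
  obtain ⟨g, hg⟩ := mulVec_surjective_of_left_kernel hM
    (Sum.elim x₀ fun p => Sum.elim (u p.1) (w p.1) p.2)
  refine ⟨g, ?_, ?_, ?_⟩
  · ext a
    have := congrFun hg (Sum.inl a)
    simpa [M, Matrix.mulVec, dotProduct, mul_comm] using this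
  · ext ⟨k, a⟩
    have := congrFun hg (Sum.inr (k, Sum.inl a))
    simpa [M, Matrix.mulVec, dotProduct, vec, hankel, vd] using this
  · ext ⟨k, a⟩
    have := congrFun hg (Sum.inr (k, Sum.inr a))
    simpa [M, Matrix.mulVec, dotProduct, vec, hankel, vd] using this

/-- Willems' fundamental lemma. -/
theorem LTISystem.IsTrajectory.exists_hankel_eq {T t : ℕ} (hcontr : S.Controllable)
    {ud : Fin T → Fin nu → ℝ} {wd : Fin T → Fin nw → ℝ} {yd : Fin T → Fin ny → ℝ}
    (hdata : S.IsTrajectory ud wd yd)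
    (hpe : PersistentlyExciting (nx + t) fun k => Sum.elim (ud k) (wd k))
    {u : Fin t → Fin nu → ℝ} {w : Fin t → Fin nw → ℝ} {y : Fin t → Fin ny → ℝ}
    (h : S.IsTrajectory u w y) :
    ∃ g : Fin (T + 1 - t) → ℝ, hankel t ud *ᵥ g = vec u ∧ hankel t wd *ᵥ g = vec w ∧
      hankel t yd *ᵥ g = vec y := by
  obtain ⟨x, hx⟩ := hdata
  obtain ⟨z, hz⟩ := h
  obtain ⟨g, hg0, hgu, hgw⟩ := exists_hankel_state_eq hcontr (fun k => (hx k).1) hpe (z 0) u w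
  have hu : ∀ k, block (hankel t ud *ᵥ g) k = u k := fun k => by rw [hgu]; rfl
  have hw : ∀ k, block (hankel t wd *ᵥ g) k = w k := fun k => by rw [hgw]; rfl
  have hs := LTISystem.next_out_hankel_mulVec hx g
  simp only [hu, hw] at hs
  -- The combined states and `z` have the same initial value and inputs, hence agree, and so do the
  -- outputs.
  have hzx : ∀ k ≤ t, ∑ c, g c • x (k + c) = z k := by
    intro k
    induction k with
    | zero => simpa using hg0
    | succ k ih =>
      intro hk
      rw [(hz ⟨k, hk⟩).1, ← ih (by omega)]
      exact (hs ⟨k, hk⟩).1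
  refine ⟨g, hgu, hgw, ?_⟩
  ext ⟨k, a⟩
  have := (hs k).2
  rw [hzx k k.2.le, ← (hz k).2] at this
  exact congrFun this a

variable {Nu Ny : ℕ}

/-- A pair of past and future data is a combination of recorded windows if and only if the future
is a realization that starts in the state in which the past ends. -/
theorem exists_hankel_past_future_iff {T Tini N : ℕ} (hcontr : S.Controllable)
    (hobs : S.Observable) (hlag : S.lag ≤ Tini) {ud : Fin T → Fin nu → ℝ}
    {wd : Fin T → Fin nw → ℝ} {yd : Fin T → Fin ny → ℝ} (hdata : S.IsTrajectory ud wd yd)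
    (hpe : PersistentlyExciting (nx + N + Tini) fun k => Sum.elim (ud k) (wd k))
    {up : Fin Tini → Fin nu → ℝ} {yp : Fin Tini → Fin ny → ℝ} {wp : Fin Tini → Fin nw → ℝ}
    {xpre x₀ : Fin nx → ℝ} (hpast : S.Steers xpre x₀ up wp yp)
    (u : Fin N × Fin nu → ℝ) (w : Fin N × Fin nw → ℝ) (y : Fin N × Fin ny → ℝ) :
    (∃ g : Fin (T + 1 - (Tini + N)) → ℝ,
      hankelPast Tini N ud *ᵥ g = vec up ∧ hankelPast Tini N yd *ᵥ g = vec yp ∧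
      hankelPast Tini N wd *ᵥ g = vec wp ∧ hankelFuture Tini N ud *ᵥ g = u ∧
      hankelFuture Tini N yd *ᵥ g = y ∧ hankelFuture Tini N wd *ᵥ g = w) ↔
    ∃ x : ℕ → Fin nx → ℝ, x 0 = x₀ ∧ ∀ k : Fin N,
      x (k + 1) = S.next (x k) (block u k) (block w k) ∧
      block y k = S.out (x k) (block u k) (block w k) := by
  obtain ⟨xp, -, hxp, hp⟩ := hpast
  constructor
  · rintro ⟨g, hpu, hpy, hpw, hfu, hfy, hfw⟩
    obtain ⟨x, hx⟩ := hdata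
    have hs := LTISystem.next_out_hankel_mulVec (t := Tini + N) hx g
    refine ⟨fun k => ∑ c, g c • x (Tini + k + c), ?_, fun k => ?_⟩
    · rw [← hxp]
      -- On the past window the combined states explain the same data as `xp`; uniqueness is used at
      -- its end, where `xp` equals `x₀`.
      refine S.state_unique (x := fun k => ∑ c, g c • x (k + c)) hobs hlag (fun k => ?_) hp
        Tini le_rfl
      have h := hs (Fin.castAdd N k)
      have hu : block (hankel (Tini + N) ud *ᵥ g) (Fin.castAdd N k) = up k :=
        congrFun (congrArg block hpu) k
      have hw : block (hankel (Tini + N) wd *ᵥ g) (Fin.castAdd N k) = wp k :=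
        congrFun (congrArg block hpw) k
      have hy : block (hankel (Tini + N) yd *ᵥ g) (Fin.castAdd N k) = yp k :=
        congrFun (congrArg block hpy) k
      rw [hu, hw, hy] at h
      exact h
    · have h := hs (Fin.natAdd Tini k)
      have hu : block (hankel (Tini + N) ud *ᵥ g) (Fin.natAdd Tini k) = block u k :=
        congrFun (congrArg block hfu) k
      have hw : block (hankel (Tini + N) wd *ᵥ g) (Fin.natAdd Tini k) = block w k :=
        congrFun (congrArg block hfw) k
      have hy : block (hankel (Tini + N) yd *ᵥ g) (Fin.natAdd Tini k) = block y k :=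
        congrFun (congrArg block hfy) k
      rw [hu, hw, hy] at h
      exact h
  · rintro ⟨x, hx0, hx⟩
    rw [show nx + N + Tini = nx + (Tini + N) by omega] at hpe
    have htraj : S.IsTrajectory (Fin.append up (block u)) (Fin.append wp (block w))
        (Fin.append yp (block y)) := by
      -- Past and future states are glued at time `Tini`, where both equal `x₀`.
      refine ⟨fun k => if k ≤ Tini then xp k else x (k - Tini), fun k => ?_⟩
      refine Fin.addCases (fun k => ?_) (fun k => ?_) k
      · have hk := k.2
        simp only [Fin.append_left, Fin.val_castAdd, if_pos hk.le, if_pos (Nat.succ_le_of_lt hk)]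
        exact hp k
      · have h1 : (if Tini + (k : ℕ) ≤ Tini then xp (Tini + k) else x (Tini + k - Tini)) = x k := by
          split_ifs with h
          · have hk : (k : ℕ) = 0 := by omega
            rw [hk, hx0, add_zero, hxp]
          · rw [Nat.add_sub_cancel_left]
        simp only [Fin.append_right, Fin.val_natAdd, h1]
        rw [if_neg (by omega), show Tini + (k : ℕ) + 1 - Tini = k + 1 by omega]
        exact hx k
    obtain ⟨g, hu, hw, hy⟩ := hdata.exists_hankel_eq hcontr hpe htraj
    refine ⟨g, ?_, ?_, ?_, ?_, ?_, ?_⟩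
    · ext ⟨k, a⟩
      exact (congrFun hu (Fin.castAdd N k, a)).trans (by simp [vec])
    · ext ⟨k, a⟩
      exact (congrFun hy (Fin.castAdd N k, a)).trans (by simp [vec])
    · ext ⟨k, a⟩
      exact (congrFun hw (Fin.castAdd N k, a)).trans (by simp [vec])
    · ext ⟨k, a⟩
      exact (congrFun hu (Fin.natAdd Tini k, a)).trans (by simp [vec, block])
    · ext ⟨k, a⟩
      exact (congrFun hy (Fin.natAdd Tini k, a)).trans (by simp [vec, block])
    · ext ⟨k, a⟩
      exact (congrFun hw (Fin.natAdd Tini k, a)).trans (by simp [vec, block])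

/-! ### Closed-loop responses -/

/-- Initial states, inputs and disturbances over a horizon of length `N`. -/
abbrev Excitation (N nx nu nw : ℕ) : Type :=
  (Fin nx → ℝ) × (Fin N → Fin nu → ℝ) × (Fin N → Fin nw → ℝ)

namespace LTISystem

variable (S)

/-- The state at time `k ≤ N` as a linear function of the excitation. -/
def stateMap (N : ℕ) : ℕ → Excitation N nx nu nw →ₗ[ℝ] (Fin nx → ℝ)
  | 0 => LinearMap.fst ℝ _ _
  | k + 1 => if h : k < N then
      S.A.mulVecLin ∘ₗ stateMap N k +
        S.B.mulVecLin ∘ₗ LinearMap.proj ⟨k, h⟩ ∘ₗ LinearMap.fst ℝ _ _ ∘ₗ LinearMap.snd ℝ _ _ +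
        S.E.mulVecLin ∘ₗ LinearMap.proj ⟨k, h⟩ ∘ₗ LinearMap.snd ℝ _ _ ∘ₗ LinearMap.snd ℝ _ _
    else 0

/-- The output at time `k < N` as a linear function of the excitation. -/
def outMap {N : ℕ} (k : Fin N) : Excitation N nx nu nw →ₗ[ℝ] (Fin ny → ℝ) :=
  S.C.mulVecLin ∘ₗ S.stateMap N k +
    S.D.mulVecLin ∘ₗ LinearMap.proj k ∘ₗ LinearMap.fst ℝ _ _ ∘ₗ LinearMap.snd ℝ _ _ +
    S.F.mulVecLin ∘ₗ LinearMap.proj k ∘ₗ LinearMap.snd ℝ _ _ ∘ₗ LinearMap.snd ℝ _ _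

theorem stateMap_succ {N : ℕ} (k : Fin N) (e : Excitation N nx nu nw) :
    S.stateMap N (k + 1) e = S.next (S.stateMap N k e) (e.2.1 k) (e.2.2 k) := by
  simp [stateMap, next]

theorem outMap_apply {N : ℕ} (k : Fin N) (e : Excitation N nx nu nw) :
    S.outMap k e = S.out (S.stateMap N k e) (e.2.1 k) (e.2.2 k) := rfl

theorem eq_stateMap {N : ℕ} {x : ℕ → Fin nx → ℝ} {e : Excitation N nx nu nw} (h0 : x 0 = e.1)
    (hx : ∀ k : Fin N, x (k + 1) = S.next (x k) (e.2.1 k) (e.2.2 k)) :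
    ∀ k ≤ N, x k = S.stateMap N k e := by
  intro k
  induction k with
  | zero => exact fun _ => h0
  | succ k ih =>
    intro hk
    rw [S.stateMap_succ ⟨k, hk⟩ e, ← ih (by omega)]
    exact hx ⟨k, hk⟩

theorem exists_state_iff {N : ℕ} (e : Excitation N nx nu nw) (y : Fin N → Fin ny → ℝ) :
    (∃ x : ℕ → Fin nx → ℝ, x 0 = e.1 ∧ ∀ k : Fin N,
      x (k + 1) = S.next (x k) (e.2.1 k) (e.2.2 k) ∧ y k = S.out (x k) (e.2.1 k) (e.2.2 k)) ↔
    ∀ k, y k = S.outMap k e := by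
  constructor
  · rintro ⟨x, h0, hx⟩ k
    rw [(hx k).2, S.eq_stateMap h0 (fun k => (hx k).1) k k.2.le, outMap_apply]
  · intro h
    exact ⟨fun k => S.stateMap N k e, rfl, fun k => ⟨S.stateMap_succ k e, h k⟩⟩

end LTISystem

variable {N : ℕ}

/-- The disturbance feedback `w ↦ K_w w`. -/
def feedback (K : (k : Fin N) → Fin k.val → Matrix (Fin nu) (Fin nw) ℝ) :
    (Fin N → Fin nw → ℝ) →ₗ[ℝ] (Fin N → Fin nu → ℝ) :=
  LinearMap.pi fun k => ∑ i : Fin k.val,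
    (K k i).mulVecLin ∘ₗ LinearMap.proj ⟨i.val, i.isLt.trans k.isLt⟩

theorem feedback_apply (K : (k : Fin N) → Fin k.val → Matrix (Fin nu) (Fin nw) ℝ)
    (w : Fin N → Fin nw → ℝ) (k : Fin N) :
    feedback K w k = ∑ i : Fin k.val, K k i *ᵥ w ⟨i.val, i.isLt.trans k.isLt⟩ := by
  simp [feedback]

theorem block_gainMatrix_mulVec (K : (k : Fin N) → Fin k.val → Matrix (Fin nu) (Fin nw) ℝ)
    (w : Fin N × Fin nw → ℝ) : block (gainMatrix K *ᵥ w) = feedback K (block w) := by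
  ext k a
  rw [feedback_apply, Finset.sum_apply]
  simp only [block, gainMatrix, Matrix.mulVec, dotProduct, Fintype.sum_prod_type,
    Matrix.of_apply]
  -- Summands extended by zero to all of `ℕ`, so that the sums over `Fin N` and over `Fin k` can be
  -- compared as sums over ranges.
  let f : ℕ → ℝ := fun i => if h : i < k then
    ∑ b, K k ⟨i, h⟩ a b * w (⟨i, h.trans k.2⟩, b) else 0
  have h1 : ∀ i : Fin N, ∑ b, (if h : i.val < k.val then K k ⟨i.val, h⟩ a b else 0) * w (i, b) =
      f i := by
    intro i
    by_cases h : i.val < k.val <;> simp [f, h]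
  have h2 : ∀ i : Fin k.val, ∑ b, K k i a b * w (⟨i.val, i.isLt.trans k.isLt⟩, b) = f i := by
    intro i
    simp [f]
  rw [Finset.sum_congr rfl fun i _ => h1 i, Finset.sum_congr rfl fun i _ => h2 i,
    Fin.sum_univ_eq_sum_range, Fin.sum_univ_eq_sum_range]
  symm
  refine Finset.sum_subset (Finset.range_mono k.2.le) fun i _ hi => ?_
  rw [Finset.mem_range] at hi
  exact dif_neg hi

/-- Nominal inputs, nominal outputs, and the linear parts of the closed-loop input and output
responses to the disturbance. -/
structure Response (N nu ny nw : ℕ) where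
  u₀ : Fin N → Fin nu → ℝ
  y₀ : Fin N → Fin ny → ℝ
  uLin : Fin N → (Fin N → Fin nw → ℝ) →ₗ[ℝ] (Fin nu → ℝ)
  yLin : Fin N → (Fin N → Fin nw → ℝ) →ₗ[ℝ] (Fin ny → ℝ)

/-- The closed-loop response with initial state `xini` and decision `z`. -/
def closedLoop (S : LTISystem nx nu ny nw) (xini : Fin nx → ℝ) (z : Decision N nu nw) :
    Response N nu ny nw where
  u₀ := z.1
  y₀ k := S.outMap k (xini, z.1, 0)
  uLin k := LinearMap.proj k ∘ₗ feedback z.2.1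
  yLin k := S.outMap k ∘ₗ LinearMap.prod 0 (LinearMap.prod (feedback z.2.1) LinearMap.id)

theorem outMap_closedLoop (xini : Fin nx → ℝ) (z : Decision N nu nw) (k : Fin N)
    (w : Fin N → Fin nw → ℝ) :
    S.outMap k (xini, z.1 + feedback z.2.1 w, w) =
      (closedLoop S xini z).y₀ k + (closedLoop S xini z).yLin k w := by
  simp [closedLoop, ← map_add]

/-- The constraints of the model-based problem for one disturbance sequence. -/
def StochasticConstraints {Ω : Type*} [MeasurableSpace Ω] (μ : Measure Ω)
    (P : OCPData nu ny nw Nu Ny) (r : Response N nu ny nw) (α : ℝ)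
    (W : Fin N → Ω → Fin nw → ℝ) : Prop :=
  ∑ k, ∫ ω, (quad P.Q (r.y₀ k + r.yLin k (W · ω)) + quad P.R (r.u₀ k + r.uLin k (W · ω))) ∂μ ≤ α ∧
    (∀ k i, 1 - P.εu ≤ μ.real {ω | P.au i ⬝ᵥ (r.u₀ k + r.uLin k (W · ω)) ≤ 1}) ∧
    (∀ k i, 1 - P.εy ≤ μ.real {ω | P.ay i ⬝ᵥ (r.y₀ k + r.yLin k (W · ω)) ≤ 1})

/-- The constraints of the data-driven problem for one family of disturbance coefficients. -/
def CoefficientConstraints (P : OCPData nu ny nw Nu Ny) (r : Response N nu ny nw) (α : ℝ)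
    (w : PCEIndex N nw → Fin N → Fin nw → ℝ) : Prop :=
  ∑ k, ((quad P.Q (r.y₀ k + r.yLin k (w (.inl ()))) + quad P.R (r.u₀ k + r.uLin k (w (.inl ())))) +
      ∑ q, (quad P.Q (r.yLin k (w (.inr q))) + quad P.R (r.uLin k (w (.inr q))))) ≤ α ∧
    (∀ k i, P.au i ⬝ᵥ (r.u₀ k + r.uLin k (w (.inl ()))) +
      sigma P.εu * Real.sqrt (∑ q, (P.au i ⬝ᵥ r.uLin k (w (.inr q))) ^ 2) ≤ 1) ∧
    (∀ k i, P.ay i ⬝ᵥ (r.y₀ k + r.yLin k (w (.inl ()))) +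
      sigma P.εy * Real.sqrt (∑ q, (P.ay i ⬝ᵥ r.yLin k (w (.inr q))) ^ 2) ≤ 1)

/-! ### Feasibility as constraints on the closed-loop response -/

theorem memLp_const_add_linearMap {Ω : Type*} [MeasurableSpace Ω] {μ : Measure Ω}
    [IsFiniteMeasure μ] {n m : ℕ} {W : Fin N → Ω → Fin n → ℝ} (hW : ∀ k, MemLp (W k) 2 μ)
    (c : Fin m → ℝ) (f : (Fin N → Fin n → ℝ) →ₗ[ℝ] (Fin m → ℝ)) :
    MemLp (fun ω => c + f (W · ω)) 2 μ := by
  have h : MemLp (fun ω => (W · ω)) 2 μ := memLp_pi_iff.2 hW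
  have h1 : MemLp (fun ω => f (W · ω)) 2 μ := (LinearMap.toContinuousLinearMap f).comp_memLp' h
  exact (memLp_const c).add h1

/-- For a given `W` the dynamics and the feedback law determine `U` and `Y` pointwise, so the
existential over processes carries no freedom; square-integrability follows since all processes are
affine in `W`. -/
theorem mem_modelFeasible_iff {Ω : Type*} [MeasurableSpace Ω] {μ : Measure Ω}
    [IsFiniteMeasure μ] {P : OCPData nu ny nw Nu Ny} {xini : Fin nx → ℝ} {z : Decision N nu nw} :
    z ∈ modelFeasible μ S P N xini ↔ ∀ W ∈ uncertaintySet μ N P.mbar P.Γbar P.ρ,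
      StochasticConstraints μ P (closedLoop S xini z) z.2.2 W := by
  refine forall₂_congr fun W hW => ?_
  have hW2 := hW.1
  constructor
  · rintro ⟨U, Y, X, -, -, -, hcost, hX0, hX, hY, hU, hcu, hcy⟩
    have hU' : ∀ k ω, U k ω = (closedLoop S xini z).u₀ k + (closedLoop S xini z).uLin k (W · ω) := by
      intro k ω
      rw [hU]
      simp [closedLoop, feedback_apply]
    have hY' : ∀ k ω, Y k ω = (closedLoop S xini z).y₀ k + (closedLoop S xini z).yLin k (W · ω) := by
      intro k ω
      rw [← outMap_closedLoop]
      refine (S.exists_state_iff (xini, z.1 + feedback z.2.1 (W · ω), (W · ω)) (Y · ω)).1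
        ⟨fun k => if h : k < N + 1 then X ⟨k, h⟩ ω else 0, ?_, fun k => ?_⟩ k
      · exact (dif_pos (Nat.succ_pos N)).trans (hX0 ω)
      · have hk := k.2
        simp only [dif_pos (show (k : ℕ) + 1 < N + 1 by omega),
          dif_pos (show (k : ℕ) < N + 1 by omega)]
        have hUk : U k ω = (z.1 + feedback z.2.1 (W · ω)) k := hU' k ω
        rw [← hUk]
        exact ⟨hX k ω, hY k ω⟩
    simp only [hU', hY'] at hcost hcu hcy
    exact ⟨hcost, hcu, hcy⟩
  · rintro ⟨hcost, hcu, hcy⟩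
    refine ⟨fun k ω => (closedLoop S xini z).u₀ k + (closedLoop S xini z).uLin k (W · ω),
      fun k ω => (closedLoop S xini z).y₀ k + (closedLoop S xini z).yLin k (W · ω),
      fun k ω => S.stateMap N k (xini, z.1 + feedback z.2.1 (W · ω), (W · ω)),
      fun k => ?_, fun k => ?_, fun k => ?_, hcost, fun ω => rfl, fun k ω => ?_, fun k ω => ?_,
      fun k ω => ?_, hcu, hcy⟩
    · exact memLp_const_add_linearMap hW2 _ _
    · exact memLp_const_add_linearMap hW2 _ _
    · have h : ∀ ω, S.stateMap N k (xini, z.1 + feedback z.2.1 (W · ω), (W · ω)) =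
          S.stateMap N k (xini, z.1, 0) + (S.stateMap N k ∘ₗ
            LinearMap.prod 0 (LinearMap.prod (feedback z.2.1) LinearMap.id)) (W · ω) := by
        intro ω
        simp [← map_add]
      simp only [h]
      exact memLp_const_add_linearMap hW2 _ _
    · exact S.stateMap_succ k _
    · exact (outMap_closedLoop xini z k (W · ω)).symm
    · simp [closedLoop, feedback_apply]

/-- The Hankel equations say that each column is a trajectory continuing its past. Column 0 thus
sees the full affine response from `xini`, while the remaining columns see only its linear part. -/
theorem mem_dataFeasible_iff {T Tini : ℕ} (hcontr : S.Controllable)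
    (hobs : S.Observable) (hlag : S.lag ≤ Tini) {ud : Fin T → Fin nu → ℝ}
    {wd : Fin T → Fin nw → ℝ} {yd : Fin T → Fin ny → ℝ} (hdata : S.IsTrajectory ud wd yd)
    (hpe : PersistentlyExciting (nx + N + Tini) fun k => Sum.elim (ud k) (wd k))
    {up : Fin Tini → Fin nu → ℝ} {yp : Fin Tini → Fin ny → ℝ} {wp : Fin Tini → Fin nw → ℝ}
    {xpre xini : Fin nx → ℝ} (hpast : S.Steers xpre xini up wp yp)
    {P : OCPData nu ny nw Nu Ny} {z : Decision N nu nw} :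
    z ∈ dataFeasible ud wd yd up yp wp P N ↔
      ∀ Wf ∈ coeffUncertaintySet N P.mbar P.Γbar P.ρ,
        CoefficientConstraints P (closedLoop S xini z) z.2.2 fun j => block (Wf.col j) := by
  -- The columns with index `j ≥ 1` have zero past, which ends in the zero state.
  have h0 : S.Steers (t := Tini) 0 0 0 0 0 :=
    ⟨0, rfl, rfl, fun k => by simp [LTISystem.next, LTISystem.out]⟩
  have hz : (vec (0 : Fin Tini → Fin nu → ℝ) = 0) ∧ (vec (0 : Fin Tini → Fin ny → ℝ) = 0) ∧
    (vec (0 : Fin Tini → Fin nw → ℝ) = 0) := ⟨rfl, rfl, rfl⟩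
  have key := fun u w y => (exists_hankel_past_future_iff hcontr hobs hlag hdata hpe hpast
    u w y).trans (S.exists_state_iff (xini, block u, block w) (block y))
  have key0 := fun u w y => (exists_hankel_past_future_iff hcontr hobs hlag hdata hpe h0
    u w y).trans (S.exists_state_iff (0, block u, block w) (block y))
  rw [hz.1, hz.2.1, hz.2.2] at key0
  refine forall₂_congr fun Wf _ => ?_
  set r := closedLoop S xini z with hr
  constructor
  · rintro ⟨u, y, g, hcost, hpu, hpy, hpw, hfu, hfy, hfw, hu0, hu, hcu, hcy⟩
    have hU0 : ∀ k, block (u (.inl ())) k = r.u₀ k + r.uLin k (block (Wf.col (.inl ()))) := by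
      intro k
      have := congrFun (block_gainMatrix_mulVec z.2.1 (Wf.col (.inl ()))) k
      rw [hu0]
      simp only [r, closedLoop, LinearMap.comp_apply, LinearMap.proj_apply, ← this]
      rfl
    have hU : ∀ q k, block (u (.inr q)) k = r.uLin k (block (Wf.col (.inr q))) := by
      intro q k
      rw [hu, block_gainMatrix_mulVec]
      rfl
    have hY0 : ∀ k, block (y (.inl ())) k = r.y₀ k + r.yLin k (block (Wf.col (.inl ()))) := by
      intro k
      rw [(key _ _ _).1 ⟨g (.inl ()), hpu _, hpy _, hpw _, hfu _, hfy _, hfw _⟩ k, hr,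
        ← outMap_closedLoop]
      congr
      ext k
      rw [hU0]
      rfl
    have hY : ∀ q k, block (y (.inr q)) k = r.yLin k (block (Wf.col (.inr q))) := by
      intro q k
      rw [(key0 _ _ _).1 ⟨g (.inr q), hpu _, hpy _, hpw _, hfu _, hfy _, hfw _⟩ k]
      have : block (u (.inr q)) = feedback z.2.1 (block (Wf.col (.inr q))) := by
        ext k
        rw [hU]
        rfl
      rw [this]
      rfl
    simp only [Fintype.sum_sum_type, Finset.univ_unique, Finset.sum_singleton,
      PUnit.default_eq_unit, hU0, hU, hY0, hY] at hcost hcu hcy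
    exact ⟨hcost, hcu, hcy⟩
  · rintro ⟨hcost, hcu, hcy⟩
    let u : PCEIndex N nw → Fin N × Fin nu → ℝ := Sum.elim
      (fun _ => vec fun k => r.u₀ k + r.uLin k (block (Wf.col (.inl ()))))
      (fun q => vec fun k => r.uLin k (block (Wf.col (.inr q))))
    let y : PCEIndex N nw → Fin N × Fin ny → ℝ := Sum.elim
      (fun _ => vec fun k => r.y₀ k + r.yLin k (block (Wf.col (.inl ()))))
      (fun q => vec fun k => r.yLin k (block (Wf.col (.inr q))))
    have hg : ∀ j, ∃ g : Fin (T + 1 - (Tini + N)) → ℝ,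
        (hankelPast Tini N ud *ᵥ g = if j = Sum.inl () then vec up else 0) ∧
        (hankelPast Tini N yd *ᵥ g = if j = Sum.inl () then vec yp else 0) ∧
        (hankelPast Tini N wd *ᵥ g = if j = Sum.inl () then vec wp else 0) ∧
        hankelFuture Tini N ud *ᵥ g = u j ∧ hankelFuture Tini N yd *ᵥ g = y j ∧
        hankelFuture Tini N wd *ᵥ g = Wf.col j := by
      rintro (⟨⟩ | q)
      · simp only [if_true]
        exact (key _ _ _).2 fun k => (outMap_closedLoop xini z k _).symm
      · simp only [reduceCtorEq, if_false]
        exact (key0 _ _ _).2 fun k => rfl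
    choose g hpu hpy hpw hfu hfy hfw using hg
    refine ⟨u, y, g, ?_, hpu, hpy, hpw, hfu, hfy, hfw, ?_, fun q => ?_, hcu, hcy⟩
    · simp only [Fintype.sum_sum_type, Finset.univ_unique, Finset.sum_singleton,
        PUnit.default_eq_unit]
      exact hcost
    · ext ⟨k, a⟩
      have := congrFun (congrFun (block_gainMatrix_mulVec z.2.1 (Wf.col (.inl ()))) k) a
      exact congrArg (z.1 k a + ·) this.symm
    · ext ⟨k, a⟩
      exact (congrFun (congrFun (block_gainMatrix_mulVec z.2.1 (Wf.col (.inr q))) k) a).symm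

/-! ### The Gelbrich distance as a Frobenius distance of square roots -/

section Gelbrich

variable {n : ℕ} {mbar : Fin n → ℝ} {Γbar : Matrix (Fin n) (Fin n) ℝ}

/-- Write `G` for `Γbar^{1/2}`. Symmetry of `G V` gives `Vᵀ G = G V`, so `(G V)² = G (V Vᵀ) G` and
the positive semidefinite `G V` is the square root in the Gelbrich formula. Its trace is the cross
term in the expansion of `‖V - G‖²`. -/
theorem frobNorm_eq_gelbrich (hΓ : Γbar.PosSemidef) {M : Matrix (Fin n) (Unit ⊕ Fin n) ℝ}
    (hM : (CFC.sqrt Γbar * M.toCols₂).PosSemidef) :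
    frobNorm (M - Matrix.fromCols (Matrix.replicateCol Unit mbar) (CFC.sqrt Γbar)) =
      gelbrich (fun a => M a (.inl ())) (M.toCols₂ * M.toCols₂ᵀ) mbar Γbar := by
  set G := CFC.sqrt Γbar with hG
  set V := M.toCols₂ with hV
  have hGG : G * G = Γbar := CFC.sqrt_mul_sqrt_self Γbar hΓ.nonneg
  have hGT : Gᵀ = G := by
    have := (Matrix.nonneg_iff_posSemidef.1 (CFC.sqrt_nonneg Γbar)).isHermitian.eq
    simpa using this
  have hVG : Vᵀ * G = G * V := by
    have := hM.isHermitian.eq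
    simpa [hGT] using this
  have hsq : CFC.sqrt (G * (V * Vᵀ) * G) = G * V := by
    refine CFC.sqrt_unique ?_ hM.nonneg
    rw [Matrix.mul_assoc G (V * Vᵀ), Matrix.mul_assoc V, hVG, Matrix.mul_assoc]
  rw [frobNorm, gelbrich, hsq]
  congr 1
  have h1 : M - Matrix.fromCols (Matrix.replicateCol Unit mbar) G =
      Matrix.fromCols (Matrix.replicateCol Unit ((fun a => M a (.inl ())) - mbar)) (V - G) := by
    ext a (⟨⟩ | b) <;> simp [hV]
  rw [h1, Matrix.transpose_fromCols, Matrix.fromCols_mul_fromRows, Matrix.trace_add]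
  congr 1
  · simp [Matrix.trace, Matrix.mul_apply, dotProduct]
  · have h2 : (G * V).trace = (V * G).trace := Matrix.trace_mul_comm _ _
    have h3 : (G * Vᵀ).trace = (V * G).trace := by
      rw [← Matrix.trace_transpose, Matrix.transpose_mul, Matrix.transpose_transpose, hGT]
    rw [Matrix.transpose_sub, hGT, sub_mul, mul_sub, mul_sub, hGG]
    simp only [Matrix.trace_sub, Matrix.trace_add, Matrix.trace_smul, h2, h3, smul_eq_mul]
    ring

/-- Every covariance matrix has a factor `V` with `Γbar^{1/2} V` positive semidefinite. -/
theorem exists_posSemidef_factor (hΓ : Γbar.PosDef) {Γ : Matrix (Fin n) (Fin n) ℝ}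
    (h : Γ.PosSemidef) :
    ∃ V : Matrix (Fin n) (Fin n) ℝ, (CFC.sqrt Γbar * V).PosSemidef ∧ V * Vᵀ = Γ := by
  set G := CFC.sqrt Γbar with hG
  have hGG : G * G = Γbar := CFC.sqrt_mul_sqrt_self Γbar hΓ.posSemidef.nonneg
  have hGT : Gᵀ = G := by
    have := (Matrix.nonneg_iff_posSemidef.1 (CFC.sqrt_nonneg Γbar)).isHermitian.eq
    simpa using this
  have hdet : IsUnit G.det := by
    have h1 : IsUnit (G.det * G.det) := by
      rw [← Matrix.det_mul, hGG]
      exact (Matrix.isUnit_iff_isUnit_det _).1 hΓ.isUnit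
    exact isUnit_of_mul_isUnit_left h1
  have hpsd : (G * Γ * G).PosSemidef := by
    have := h.mul_mul_conjTranspose_same G
    simpa [hGT] using this
  set R := CFC.sqrt (G * Γ * G) with hR
  have hRR : R * R = G * Γ * G := CFC.sqrt_mul_sqrt_self _ hpsd.nonneg
  have hRT : Rᵀ = R := by
    have := (Matrix.nonneg_iff_posSemidef.1 (CFC.sqrt_nonneg (G * Γ * G))).isHermitian.eq
    simpa using this
  -- The condition `G V = (G Γ G)^{1/2}` leaves only this choice of `V`.
  refine ⟨G⁻¹ * R, ?_, ?_⟩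
  · rw [Matrix.mul_nonsing_inv_cancel_left _ _ hdet]
    exact (Matrix.nonneg_iff_posSemidef.1 (CFC.sqrt_nonneg _))
  · rw [Matrix.transpose_mul, hRT, Matrix.transpose_nonsing_inv, hGT, Matrix.mul_assoc,
      ← Matrix.mul_assoc R, hRR, Matrix.mul_assoc G, Matrix.mul_assoc G,
      Matrix.nonsing_inv_mul_cancel_left _ _ hdet, Matrix.mul_assoc, Matrix.mul_nonsing_inv _ hdet,
      Matrix.mul_one]

theorem exists_mem_coeffAmbiguitySet {ρ : ℝ} (hΓ : Γbar.PosDef) {m : Fin n → ℝ}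
    {Γ : Matrix (Fin n) (Fin n) ℝ} (h : Γ.PosSemidef) (hd : gelbrich m Γ mbar Γbar ≤ ρ) :
    ∃ M ∈ coeffAmbiguitySet mbar Γbar ρ, (fun a => M a (.inl ())) = m ∧
      M.toCols₂ * M.toCols₂ᵀ = Γ := by
  obtain ⟨V, hV, hVV⟩ := exists_posSemidef_factor hΓ h
  have h2 : (Matrix.fromCols (Matrix.replicateCol Unit m) V).toCols₂ = V :=
    Matrix.toCols₂_fromCols _ _
  refine ⟨Matrix.fromCols (Matrix.replicateCol Unit m) V, ⟨?_, ?_⟩, rfl, ?_⟩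
  · rw [frobNorm_eq_gelbrich hΓ.posSemidef (by rwa [h2]), h2, hVV]
    exact hd
  · rwa [h2]
  · rw [h2, hVV]

theorem center_mem_coeffAmbiguitySet {ρ : ℝ} (hΓ : Γbar.PosSemidef) (hρ : 0 ≤ ρ) :
    Matrix.fromCols (Matrix.replicateCol Unit mbar) (CFC.sqrt Γbar) ∈
      coeffAmbiguitySet mbar Γbar ρ := by
  refine ⟨by simpa [frobNorm] using hρ, ?_⟩
  rw [Matrix.toCols₂_fromCols, CFC.sqrt_mul_sqrt_self Γbar hΓ.nonneg]
  exact hΓ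

theorem gelbrich_le_of_mem_coeffAmbiguitySet {ρ : ℝ} (hΓ : Γbar.PosSemidef)
    {M : Matrix (Fin n) (Unit ⊕ Fin n) ℝ} (hM : M ∈ coeffAmbiguitySet mbar Γbar ρ) :
    gelbrich (fun a => M a (.inl ())) (M.toCols₂ * M.toCols₂ᵀ) mbar Γbar ≤ ρ := by
  rw [← frobNorm_eq_gelbrich hΓ hM.2]
  exact hM.1

end Gelbrich

/-! ### Moments of linear functionals of the disturbance -/

section Moments

variable {Ω : Type*} [MeasurableSpace Ω] {μ : Measure Ω} {N n : ℕ}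

/-- `W` is a square-integrable sequence, uncorrelated in time, with mean `m` and covariance
matrix `V Vᵀ` at all times. -/
structure HasMoments (μ : Measure Ω) (W : Fin N → Ω → Fin n → ℝ) (m : Fin n → ℝ)
    (V : Matrix (Fin n) (Fin n) ℝ) : Prop where
  memLp : ∀ k, MemLp (W k) 2 μ
  mean : ∀ k a, ∫ ω, W k ω a ∂μ = m a
  cov : ∀ k i a b, cov[fun ω => W k ω a, fun ω => W i ω b; μ] =
    if k = i then (V * Vᵀ) a b else 0

/-- The sequences of coefficients `[1_N ⊗ m, I_N ⊗ V]`. -/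
def coeffSeq (N : ℕ) (m : Fin n → ℝ) (V : Matrix (Fin n) (Fin n) ℝ) :
    PCEIndex N n → Fin N → Fin n → ℝ :=
  Sum.elim (fun _ _ => m) fun q k a => (1 : Matrix (Fin N) (Fin N) ℝ) k q.1 * V a q.2

theorem exists_coord_eq (f : (Fin N → Fin n → ℝ) →ₗ[ℝ] ℝ) :
    ∃ c : Fin N × Fin n → ℝ, ∀ w, f w = ∑ p, c p * w p.1 p.2 := by
  refine ⟨fun p => f (Pi.single p.1 (Pi.single p.2 1)), fun w => ?_⟩
  have h : w = ∑ p : Fin N × Fin n, w p.1 p.2 • Pi.single p.1 (Pi.single p.2 1) := by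
    ext k a
    rw [Finset.sum_apply, Finset.sum_apply, Finset.sum_eq_single (k, a)]
    · simp
    · rintro ⟨i, b⟩ - hp
      by_cases hi : k = i
      · subst hi
        have hb : a ≠ b := fun hb => hp (by rw [hb])
        simp [hb]
      · simp [hi]
    · simp
  conv_lhs => rw [h]
  simp [map_sum, mul_comm]

namespace HasMoments

variable {W : Fin N → Ω → Fin n → ℝ} {m : Fin n → ℝ} {V : Matrix (Fin n) (Fin n) ℝ}

theorem memLp_apply (h : HasMoments μ W m V) (k : Fin N) (a : Fin n) :
    MemLp (fun ω => W k ω a) 2 μ := memLp_pi_iff.1 (h.memLp k) a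

theorem memLp_linear (h : HasMoments μ W m V) (f : (Fin N → Fin n → ℝ) →ₗ[ℝ] ℝ) :
    MemLp (fun ω => f (W · ω)) 2 μ := by
  obtain ⟨c, hc⟩ := exists_coord_eq f
  simp only [hc]
  exact memLp_finsetSum _ fun p _ => (h.memLp_apply p.1 p.2).const_mul _

theorem integral_linear [IsProbabilityMeasure μ] (h : HasMoments μ W m V) (f : (Fin N → Fin n → ℝ) →ₗ[ℝ] ℝ) :
    ∫ ω, f (W · ω) ∂μ = f fun _ => m := by
  obtain ⟨c, hc⟩ := exists_coord_eq f
  simp only [hc]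
  rw [integral_finsetSum]
  · refine Finset.sum_congr rfl fun p _ => ?_
    rw [integral_const_mul, h.mean]
  · exact fun p _ => ((h.memLp_apply p.1 p.2).integrable one_le_two).const_mul _

variable [IsProbabilityMeasure μ]

/-- The joint covariance of the sequence is `I ⊗ V Vᵀ = (I ⊗ V)(I ⊗ V)ᵀ`, so covariances of
functionals are inner products of their values on the columns of `I ⊗ V`. -/
theorem cov_linear (h : HasMoments μ W m V) (f g : (Fin N → Fin n → ℝ) →ₗ[ℝ] ℝ) :
    cov[fun ω => f (W · ω), fun ω => g (W · ω); μ] =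
      ∑ q, f (coeffSeq N m V (.inr q)) * g (coeffSeq N m V (.inr q)) := by
  obtain ⟨c, hc⟩ := exists_coord_eq f
  obtain ⟨d, hd⟩ := exists_coord_eq g
  simp only [hc, hd]
  rw [covariance_fun_sum_fun_sum (X := fun (p : Fin N × Fin n) ω => c p * W p.1 ω p.2)
    (Y := fun (p : Fin N × Fin n) ω => d p * W p.1 ω p.2)
    (fun p => (h.memLp_apply p.1 p.2).const_mul _) (fun p => (h.memLp_apply p.1 p.2).const_mul _)]
  simp only [covariance_const_mul_left, covariance_const_mul_right, h.cov, coeffSeq,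
    Sum.elim_inr, Finset.sum_mul_sum]
  conv_rhs => rw [Finset.sum_comm]
  refine Finset.sum_congr rfl fun p _ => ?_
  conv_rhs => rw [Finset.sum_comm]
  refine Finset.sum_congr rfl fun p' _ => ?_
  have h1 : ∑ q : Fin N × Fin n, (1 : Matrix (Fin N) (Fin N) ℝ) p.1 q.1 * V p.2 q.2 *
      ((1 : Matrix (Fin N) (Fin N) ℝ) p'.1 q.1 * V p'.2 q.2) =
      if p.1 = p'.1 then (V * Vᵀ) p.2 p'.2 else 0 := by
    obtain ⟨k, a⟩ := p
    obtain ⟨k', a'⟩ := p'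
    dsimp only
    rw [Fintype.sum_prod_type, Finset.sum_eq_single k]
    · by_cases hk : k = k'
      · subst hk
        simp only [Matrix.one_apply_eq, one_mul, if_true, Matrix.mul_apply,
          Matrix.transpose_apply]
      · simp [hk, eq_comm (a := k')]
    · intro i _ hi
      simp [hi.symm]
    · simp
  rw [← h1, Finset.mul_sum, Finset.mul_sum]
  refine Finset.sum_congr rfl fun q _ => ?_
  ring

theorem memLp_affine (h : HasMoments μ W m V) (c : ℝ) (f : (Fin N → Fin n → ℝ) →ₗ[ℝ] ℝ) :
    MemLp (fun ω => c + f (W · ω)) 2 μ := (memLp_const c).add (h.memLp_linear f)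

theorem integral_affine (h : HasMoments μ W m V) (c : ℝ) (f : (Fin N → Fin n → ℝ) →ₗ[ℝ] ℝ) :
    ∫ ω, (c + f (W · ω)) ∂μ = c + f (coeffSeq N m V (.inl ())) := by
  rw [integral_add (integrable_const _) ((h.memLp_linear f).integrable one_le_two),
    h.integral_linear]
  simp [coeffSeq]

theorem cov_affine (h : HasMoments μ W m V) (c d : ℝ) (f g : (Fin N → Fin n → ℝ) →ₗ[ℝ] ℝ) :
    cov[fun ω => c + f (W · ω), fun ω => d + g (W · ω); μ] =
      ∑ q, f (coeffSeq N m V (.inr q)) * g (coeffSeq N m V (.inr q)) := by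
  rw [covariance_const_add_left ((h.memLp_linear f).integrable one_le_two),
    covariance_const_add_right ((h.memLp_linear g).integrable one_le_two), h.cov_linear]

theorem integral_affine_mul (h : HasMoments μ W m V) (c d : ℝ)
    (f g : (Fin N → Fin n → ℝ) →ₗ[ℝ] ℝ) :
    ∫ ω, (c + f (W · ω)) * (d + g (W · ω)) ∂μ =
      (c + f (coeffSeq N m V (.inl ()))) * (d + g (coeffSeq N m V (.inl ()))) +
        ∑ q, f (coeffSeq N m V (.inr q)) * g (coeffSeq N m V (.inr q)) := by
  rw [← h.cov_affine c d f g, covariance_eq_sub (h.memLp_affine c f) (h.memLp_affine d g),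
    h.integral_affine, h.integral_affine]
  simp

theorem quad_eq_sum {ι : Type} [Fintype ι] (Q : Matrix ι ι ℝ) (x : ι → ℝ) :
    quad Q x = ∑ a, ∑ b, Q a b * (x a * x b) := by
  simp only [quad, dotProduct, Matrix.mulVec, Finset.mul_sum]
  refine Finset.sum_congr rfl fun a _ => Finset.sum_congr rfl fun b _ => ?_
  ring

theorem integrable_mul_affine (h : HasMoments μ W m V) (c d : ℝ)
    (f g : (Fin N → Fin n → ℝ) →ₗ[ℝ] ℝ) :
    Integrable (fun ω => (c + f (W · ω)) * (d + g (W · ω))) μ :=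
  (h.memLp_affine c f).integrable_mul (h.memLp_affine d g)

theorem integrable_quad (h : HasMoments μ W m V) {ι : Type} [Fintype ι] (Q : Matrix ι ι ℝ)
    (c : ι → ℝ) (f : (Fin N → Fin n → ℝ) →ₗ[ℝ] (ι → ℝ)) :
    Integrable (fun ω => quad Q (c + f (W · ω))) μ := by
  simp only [quad_eq_sum]
  refine integrable_finsetSum _ fun a _ => integrable_finsetSum _ fun b _ => ?_
  exact (h.integrable_mul_affine (c a) (c b) (LinearMap.proj a ∘ₗ f)
    (LinearMap.proj b ∘ₗ f)).const_mul _

theorem integral_quad (h : HasMoments μ W m V) {ι : Type} [Fintype ι] (Q : Matrix ι ι ℝ)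
    (c : ι → ℝ) (f : (Fin N → Fin n → ℝ) →ₗ[ℝ] (ι → ℝ)) :
    ∫ ω, quad Q (c + f (W · ω)) ∂μ = quad Q (c + f (coeffSeq N m V (.inl ()))) +
      ∑ q, quad Q (f (coeffSeq N m V (.inr q))) := by
  have hi : ∀ a b, Integrable (fun ω => Q a b * ((c + f (W · ω)) a * (c + f (W · ω)) b)) μ :=
    fun a b => (h.integrable_mul_affine (c a) (c b) (LinearMap.proj a ∘ₗ f)
      (LinearMap.proj b ∘ₗ f)).const_mul _
  have hv : ∀ a b, ∫ ω, (c + f (W · ω)) a * (c + f (W · ω)) b ∂μ = _ := fun a b =>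
    h.integral_affine_mul (c a) (c b) (LinearMap.proj a ∘ₗ f) (LinearMap.proj b ∘ₗ f)
  simp only [quad_eq_sum]
  rw [integral_finsetSum _ fun a _ => integrable_finsetSum _ fun b _ => hi a b,
    Finset.sum_comm (s := (Finset.univ : Finset (Fin N × Fin n))), ← Finset.sum_add_distrib]
  refine Finset.sum_congr rfl fun a _ => ?_
  rw [integral_finsetSum _ fun b _ => hi a b,
    Finset.sum_comm (s := (Finset.univ : Finset (Fin N × Fin n))), ← Finset.sum_add_distrib]
  refine Finset.sum_congr rfl fun b _ => ?_
  rw [integral_const_mul, hv, mul_add, Finset.mul_sum]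
  rfl

end HasMoments

/-! ### Cantelli's inequality -/

/-- Cantelli's inequality: Markov's inequality for `(X - c + s)²` with the best shift `s` bounds the
probability of `1 < X` by `v / (v + t²)`, where `t = 1 - c`; the hypothesis makes this at most `ε`.
-/
theorem one_sub_le_measureReal_le_one [IsProbabilityMeasure μ] {X : Ω → ℝ} (hX : MemLp X 2 μ) {ε : ℝ}
    (hε : ε ∈ Set.Ioo (0 : ℝ) 1) (h : ∫ ω, X ω ∂μ + sigma ε * Real.sqrt cov[X, X; μ] ≤ 1) :
    1 - ε ≤ μ.real {ω | X ω ≤ 1} := by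
  obtain ⟨hε0, hε1⟩ := hε
  set c := ∫ ω, X ω ∂μ with hc
  set v := cov[X, X; μ] with hv
  have hv0 : 0 ≤ v := integral_nonneg fun ω => mul_self_nonneg _
  have hσ : 0 < sigma ε := Real.sqrt_pos.2 (div_pos (by linarith) hε0)
  have hXc : MemLp (fun ω => X ω - c) 2 μ := hX.sub (memLp_const c)
  have hint : ∀ s, ∫ ω, (X ω - c + s) ^ 2 ∂μ = v + s ^ 2 := by
    intro s
    have h1 : ∀ ω, (X ω - c + s) ^ 2 =
        (X ω - c) * (X ω - c) + (2 * s * (X ω - c) + s ^ 2) := fun ω => by ring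
    have h2 : Integrable (fun ω => X ω - c) μ := hXc.integrable one_le_two
    simp only [h1]
    have h3 : Integrable (fun ω => (X ω - c) * (X ω - c)) μ := hXc.integrable_mul hXc
    have h4 : Integrable (fun ω => 2 * s * (X ω - c) + s ^ 2) μ :=
      (h2.const_mul _).add (integrable_const _)
    rw [integral_add h3 h4,
      integral_add (h2.const_mul _) (integrable_const _), integral_const_mul,
      integral_sub (hX.integrable one_le_two) (integrable_const _)]
    simp [hv, covariance, ← hc]
  have hcompl : 1 ≤ μ.real {ω | X ω ≤ 1} + μ.real {ω | 1 < X ω} := by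
    have h1 : {ω | X ω ≤ 1} ∪ {ω | 1 < X ω} = Set.univ := by
      ext ω
      simpa using le_or_gt (X ω) 1
    have h2 := measureReal_union_le (μ := μ) {ω | X ω ≤ 1} {ω | 1 < X ω}
    rwa [h1, probReal_univ] at h2
  suffices μ.real {ω | 1 < X ω} ≤ ε by linarith
  have hsv : 0 ≤ sigma ε * Real.sqrt v := mul_nonneg hσ.le (Real.sqrt_nonneg _)
  -- If `c ≥ 1`, the hypothesis leaves only `c = 1` and `v = 0`, so `X` is almost surely constant.
  rcases le_or_gt (1 - c) 0 with ht | ht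
  · have h1 : sigma ε * Real.sqrt v = 0 := le_antisymm (by linarith) hsv
    have h2 : v = 0 := by
      rcases mul_eq_zero.1 h1 with h1 | h1
      · exact absurd h1 hσ.ne'
      · exact (Real.sqrt_eq_zero hv0).1 h1
    have h3 := hint 0
    simp only [add_zero, h2, ne_eq, OfNat.ofNat_ne_zero, not_false_eq_true, zero_pow] at h3
    rw [integral_eq_zero_iff_of_nonneg (fun ω => sq_nonneg _) hXc.integrable_sq] at h3
    have h4 : μ.real {ω | 1 < X ω} = 0 := by
      rw [measureReal_eq_zero_iff]
      refine measure_mono_null (fun ω hω => ?_) (ae_iff.1 h3)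
      simp only [Set.mem_ofPred_eq, Pi.zero_apply, pow_eq_zero_iff, ne_eq, OfNat.ofNat_ne_zero,
        not_false_eq_true, sub_eq_zero] at hω ⊢
      intro h5
      linarith
    rw [h4]
    exact hε0.le
  · set t := 1 - c with ht'
    have hs : 0 ≤ v / t := div_nonneg hv0 ht.le
    -- The shift `s = v / t` minimizes `(v + s²) / (t + s)²`.
    have hmark := mul_meas_ge_le_integral_of_nonneg (μ := μ)
      (f := fun ω => (X ω - c + v / t) ^ 2) (Filter.Eventually.of_forall fun ω => sq_nonneg _)
      (hXc.add (memLp_const (v / t))).integrable_sq ((t + v / t) ^ 2)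
    rw [hint] at hmark
    have hsub : μ.real {ω | 1 < X ω} ≤
        μ.real {ω | (t + v / t) ^ 2 ≤ (X ω - c + v / t) ^ 2} := by
      refine measureReal_mono fun ω hω => ?_
      have hω : 1 < X ω := hω
      have h0 : t + v / t ≤ X ω - c + v / t := by linarith
      exact pow_le_pow_left₀ (add_nonneg ht.le hs) h0 2
    have hvt : v * (1 - ε) ≤ ε * t ^ 2 := by
      have h1 : (sigma ε * Real.sqrt v) ^ 2 ≤ t ^ 2 := pow_le_pow_left₀ hsv (by linarith) 2
      rw [mul_pow, Real.sq_sqrt hv0, sigma,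
        Real.sq_sqrt (div_nonneg (by linarith) hε0.le)] at h1
      have h2 := mul_le_mul_of_nonneg_left h1 hε0.le
      have h3 : ε * ((1 - ε) / ε * v) = v * (1 - ε) := by field_simp
      linarith
    have hpos : 0 < (t + v / t) ^ 2 := by positivity
    refine hsub.trans (le_of_mul_le_mul_left (hmark.trans ?_) hpos)
    have h1 : (t + v / t) ^ 2 * ε - (v + (v / t) ^ 2) =
        (t ^ 2 + v) * (ε * t ^ 2 - v * (1 - ε)) / t ^ 2 := by
      field_simp
      ring
    have h2 : 0 ≤ (t ^ 2 + v) * (ε * t ^ 2 - v * (1 - ε)) / t ^ 2 := by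
      have : 0 ≤ ε * t ^ 2 - v * (1 - ε) := by linarith
      positivity
    linarith

/-! ### Members of the uncertainty set -/

variable {W : Fin N → Ω → Fin n → ℝ} {mbar : Fin n → ℝ} {Γbar : Matrix (Fin n) (Fin n) ℝ} {ρ : ℝ}

theorem mean_cov_of_map_mem_distributions {X : Ω → Fin n → ℝ} (hX : MemLp X 2 μ)
    {m : Fin n → ℝ} {Γ : Matrix (Fin n) (Fin n) ℝ} (h : μ.map X ∈ distributions m Γ) :
    (∀ a, ∫ ω, X ω a ∂μ = m a) ∧ ∀ a b, cov[fun ω => X ω a, fun ω => X ω b; μ] = Γ a b := by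
  have hm := hX.aestronglyMeasurable.aemeasurable
  obtain ⟨-, -, h1, h2⟩ := h
  refine ⟨fun a => ?_, fun a b => ?_⟩
  · rw [← h1 a, integral_map hm (measurable_pi_apply a).aestronglyMeasurable]
  · rw [← h2 a b, covariance_map (measurable_pi_apply a).aestronglyMeasurable
      (measurable_pi_apply b).aestronglyMeasurable hm]
    rfl

theorem map_mem_distributions [IsProbabilityMeasure μ] {X : Ω → Fin n → ℝ} (hX : MemLp X 2 μ)
    {m : Fin n → ℝ} {Γ : Matrix (Fin n) (Fin n) ℝ} (h1 : ∀ a, ∫ ω, X ω a ∂μ = m a)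
    (h2 : ∀ a b, cov[fun ω => X ω a, fun ω => X ω b; μ] = Γ a b) :
    μ.map X ∈ distributions m Γ := by
  have hm := hX.aestronglyMeasurable.aemeasurable
  refine ⟨Measure.isProbabilityMeasure_map hm,
    (memLp_map_measure_iff aestronglyMeasurable_id hm).2 hX, fun a => ?_, fun a b => ?_⟩
  · rw [← h1 a, integral_map hm (measurable_pi_apply a).aestronglyMeasurable]
  · rw [← h2 a b, covariance_map (measurable_pi_apply a).aestronglyMeasurable
      (measurable_pi_apply b).aestronglyMeasurable hm]
    rfl

theorem exists_hasMoments_of_mem_uncertaintySet [IsProbabilityMeasure μ] (hΓ : Γbar.PosDef) (hρ : 0 ≤ ρ)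
    (hW : W ∈ uncertaintySet μ N mbar Γbar ρ) :
    ∃ M ∈ coeffAmbiguitySet mbar Γbar ρ, HasMoments μ W (fun a => M a (.inl ())) M.toCols₂ := by
  obtain ⟨hL, hA, ⟨m, Γ, hD⟩, hC⟩ := hW
  rcases Nat.eq_zero_or_pos N with rfl | hN
  -- An empty sequence has no moments to read off, so the centre of the ball serves; this is where
  -- `ρ ≥ 0` enters.
  · exact ⟨_, center_mem_coeffAmbiguitySet hΓ.posSemidef hρ, hL, fun k => k.elim0,
      fun k => k.elim0⟩
  · obtain ⟨m', Γ', hD', hPSD, hG⟩ := hA ⟨0, hN⟩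
    obtain ⟨h1, h2⟩ := mean_cov_of_map_mem_distributions (hL ⟨0, hN⟩) hD'
    obtain ⟨h1', h2'⟩ := mean_cov_of_map_mem_distributions (hL ⟨0, hN⟩) (hD ⟨0, hN⟩)
    have hm : m' = m := by
      ext a
      rw [← h1, h1']
    have hΓ' : Γ' = Γ := by
      ext a b
      rw [← h2, h2']
    subst hm hΓ'
    obtain ⟨M, hM, hM1, hM2⟩ := exists_mem_coeffAmbiguitySet hΓ hPSD hG
    refine ⟨M, hM, hL, fun k a => ?_, fun k i a b => ?_⟩
    · rw [(mean_cov_of_map_mem_distributions (hL k) (hD k)).1]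
      exact (congrFun hM1 a).symm
    · split_ifs with hk
      · rw [hM2, hk, (mean_cov_of_map_mem_distributions (hL i) (hD i)).2]
      · exact hC k i hk a b

theorem HasMoments.mem_uncertaintySet [IsProbabilityMeasure μ] (hΓ : Γbar.PosSemidef)
    {M : Matrix (Fin n) (Unit ⊕ Fin n) ℝ} (hM : M ∈ coeffAmbiguitySet mbar Γbar ρ)
    (h : HasMoments μ W (fun a => M a (.inl ())) M.toCols₂) :
    W ∈ uncertaintySet μ N mbar Γbar ρ := by
  have hD : ∀ k, μ.map (W k) ∈ distributions (fun a => M a (.inl ())) (M.toCols₂ * M.toCols₂ᵀ) :=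
    fun k => map_mem_distributions (h.memLp k) (h.mean k) fun a b => by rw [h.cov, if_pos rfl]
  refine ⟨h.memLp, fun k => ⟨_, _, hD k, ?_, gelbrich_le_of_mem_coeffAmbiguitySet hΓ hM⟩,
    ⟨_, _, hD⟩, fun k i hk a b => by rw [h.cov, if_neg hk]⟩
  simpa using Matrix.posSemidef_self_mul_conjTranspose M.toCols₂

theorem block_col_eq_coeffSeq {M : Matrix (Fin n) (Unit ⊕ Fin n) ℝ} :
    (fun j => block ((Matrix.fromCols (Matrix.of fun (p : Fin N × Fin n) u => M.toCols₁ p.2 u)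
      ((1 : Matrix (Fin N) (Fin N) ℝ) ⊗ₖ M.toCols₂)).col j)) =
      coeffSeq N (fun a => M a (.inl ())) M.toCols₂ := by
  ext (⟨⟩ | q) k a
  · rfl
  · rfl

end Moments

/-! ### Orthonormal noise with an extremal component -/

section Noise

variable {Ω : Type*} [MeasurableSpace Ω] {μ : Measure Ω}

theorem integral_cos_period {p : ℝ} (hp : 0 < p) {k : ℤ} (hk : k ≠ 0) :
    ∫ x in (0 : ℝ)..p, Real.cos (2 * Real.pi * k / p * x) = 0 := by
  have hk' : (k : ℝ) ≠ 0 := Int.cast_ne_zero.2 hk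
  have hc : 2 * Real.pi * k / p ≠ 0 := by positivity
  rw [intervalIntegral.integral_comp_mul_left _ hc, integral_cos]
  have h : 2 * Real.pi * k / p * p = (2 * k : ℤ) * Real.pi := by
    push_cast
    field_simp
  rw [h, Real.sin_int_mul_pi]
  simp

theorem integral_cos_mul_cos {p : ℝ} (hp : 0 < p) (i j : ℕ) :
    ∫ x in (0 : ℝ)..p, Real.cos (2 * Real.pi * (i + 1) / p * x) *
      Real.cos (2 * Real.pi * (j + 1) / p * x) = if i = j then p / 2 else 0 := by
  have h : ∀ x, Real.cos (2 * Real.pi * (i + 1) / p * x) *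
      Real.cos (2 * Real.pi * (j + 1) / p * x) =
      (Real.cos (2 * Real.pi * ((i - j : ℤ) : ℝ) / p * x) +
        Real.cos (2 * Real.pi * ((i + j + 2 : ℤ) : ℝ) / p * x)) / 2 := by
    intro x
    rw [show 2 * Real.pi * ((i - j : ℤ) : ℝ) / p * x = 2 * Real.pi * (i + 1) / p * x -
      2 * Real.pi * (j + 1) / p * x by push_cast; ring,
      show 2 * Real.pi * ((i + j + 2 : ℤ) : ℝ) / p * x = 2 * Real.pi * (i + 1) / p * x +
      2 * Real.pi * (j + 1) / p * x by push_cast; ring, Real.cos_sub, Real.cos_add]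
    ring
  simp only [h]
  rw [intervalIntegral.integral_div, intervalIntegral.integral_add
    (Continuous.intervalIntegrable (by fun_prop) _ _)
    (Continuous.intervalIntegrable (by fun_prop) _ _),
    integral_cos_period hp (by omega : (i + j + 2 : ℤ) ≠ 0)]
  split_ifs with hij
  · simp [hij]
  · rw [integral_cos_period hp (by omega : (i - j : ℤ) ≠ 0)]
    simp

theorem integral_comp_ite_uniform {U : Ω → ℝ} (hU : Measurable U)
    (hmap : μ.map U = volume.restrict (Set.Icc (0 : ℝ) 1)) {p : ℝ} (hp : p ∈ Set.Ioo (0 : ℝ) 1)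
    {g : ℝ → ℝ} (hg : Continuous g) (c : ℝ) :
    ∫ ω, (if U ω < p then g (U ω) else c) ∂μ = (∫ x in (0 : ℝ)..p, g x) + (1 - p) * c := by
  obtain ⟨hp0, hp1⟩ := hp
  have hm : Measurable fun x : ℝ => if x < p then g x else c :=
    Measurable.ite measurableSet_Iio hg.measurable measurable_const
  have h1 : ∫ ω, (if U ω < p then g (U ω) else c) ∂μ =
      ∫ x in Set.Icc (0 : ℝ) 1, if x < p then g x else c := by
    rw [← hmap, integral_map hU.aemeasurable hm.aestronglyMeasurable]
  have hE1 : Set.EqOn (fun x : ℝ => if x < p then g x else c) g (Set.Ico 0 p) :=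
    fun x hx => if_pos hx.2
  have hE2 : Set.EqOn (fun x : ℝ => if x < p then g x else c) (fun _ => c) (Set.Icc p 1) :=
    fun x hx => if_neg (not_lt.2 hx.1)
  have hI1 : IntegrableOn (fun x : ℝ => if x < p then g x else c) (Set.Ico 0 p) :=
    (integrableOn_congr_fun hE1 measurableSet_Ico).2
      ((hg.integrableOn_Icc (a := 0) (b := p)).mono_set Set.Ico_subset_Icc_self)
  have hI2 : IntegrableOn (fun x : ℝ => if x < p then g x else c) (Set.Icc p 1) :=
    (integrableOn_congr_fun hE2 measurableSet_Icc).2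
      (continuous_const.integrableOn_Icc (a := p) (b := 1))
  have hdisj : Disjoint (Set.Ico 0 p) (Set.Icc p 1) :=
    Set.disjoint_left.2 fun x hx hx' => absurd hx.2 (not_lt.2 hx'.1)
  rw [h1, ← Set.Ico_union_Icc_eq_Icc hp0.le hp1.le,
    setIntegral_union hdisj measurableSet_Icc hI1 hI2, setIntegral_congr_fun measurableSet_Ico hE1,
    setIntegral_congr_fun measurableSet_Icc hE2, integral_Ico_eq_integral_Ioc,
    ← intervalIntegral.integral_of_le hp0.le, setIntegral_const]
  simp [hp1.le]

/-- Mean-zero orthonormal functions of a uniform random variable; the one with index `none` takes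
its larger value with probability `p`. -/
theorem exists_noise (hΩ : ∃ V : Ω → ℝ, Measurable V ∧ μ.map V = volume.restrict (Set.Icc (0 : ℝ) 1))
    [IsProbabilityMeasure μ] {p : ℝ} (hp : p ∈ Set.Ioo (0 : ℝ) 1) (ι : Type*) [Fintype ι]
    [DecidableEq ι] :
    ∃ (b : Option ι → Ω → ℝ) (A : Set Ω), (∀ o, MemLp (b o) 2 μ) ∧ (∀ o, ∫ ω, b o ω ∂μ = 0) ∧
      (∀ o o', ∫ ω, b o ω * b o' ω ∂μ = if o = o' then 1 else 0) ∧ μ.real A = p ∧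
      ∀ ω ∈ A, b none ω = sigma p := by
  obtain ⟨U, hU, hmap⟩ := hΩ
  have hp0 := hp.1
  have hp1 := hp.2
  set s := sigma p with hs
  have hs2 : s ^ 2 = (1 - p) / p := Real.sq_sqrt (div_nonneg (by linarith) hp0.le)
  have hs0 : 0 < s := Real.sqrt_pos.2 (div_pos (by linarith) hp0)
  have hsp : p * s ^ 2 = 1 - p := by
    rw [hs2]
    field_simp
  let j : ι → ℕ := fun q => Fintype.equivFin ι q
  have hj : ∀ q q', j q = j q' ↔ q = q' := fun q q' => by
    simp only [j, Fin.val_inj, EmbeddingLike.apply_eq_iff_eq]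
  -- The index `none` gives the two-point variable with value `s` on `U < p` and `-1/s` elsewhere,
  -- which has mean 0 and variance 1. The others are scaled cosines of distinct nonzero frequencies
  -- on `[0, p]`, zero elsewhere: being orthogonal to constants on `[0, p]`, they have mean 0 and
  -- are orthogonal to the first.
  let g : Option ι → ℝ → ℝ := fun o x => o.elim s fun q =>
    Real.sqrt (2 / p) * Real.cos (2 * Real.pi * (j q + 1) / p * x)
  let c : Option ι → ℝ := fun o => o.elim (-s⁻¹) fun _ => 0
  have hg : ∀ o, Continuous (g o) := by
    rintro (_ | q)
    · exact continuous_const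
    · change Continuous fun x => Real.sqrt (2 / p) * Real.cos (2 * Real.pi * (j q + 1) / p * x)
      fun_prop
  have hgb : ∀ o, ∃ B, ∀ x, |g o x| ≤ B := by
    rintro (_ | q)
    · exact ⟨|s|, fun x => le_rfl⟩
    · refine ⟨Real.sqrt (2 / p), fun x => ?_⟩
      change |Real.sqrt (2 / p) * Real.cos _| ≤ _
      rw [abs_mul, abs_of_nonneg (Real.sqrt_nonneg _)]
      exact mul_le_of_le_one_right (Real.sqrt_nonneg _) (Real.abs_cos_le_one _)
  have hmean : ∀ q, ∫ x in (0 : ℝ)..p, Real.cos (2 * Real.pi * (j q + 1) / p * x) = 0 := by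
    intro q
    have h := integral_cos_period hp0 (k := j q + 1) (by omega)
    push_cast at h
    exact h
  have hw : Real.sqrt (2 / p) * Real.sqrt (2 / p) = 2 / p := Real.mul_self_sqrt (by positivity)
  refine ⟨fun o ω => if U ω < p then g o (U ω) else c o, {ω | U ω < p}, fun o => ?_, fun o => ?_,
    fun o o' => ?_, ?_, fun ω hω => if_pos hω⟩
  · obtain ⟨B, hB⟩ := hgb o
    have hm : Measurable fun x : ℝ => if x < p then g o x else c o :=
      Measurable.ite measurableSet_Iio (hg o).measurable measurable_const
    refine MemLp.of_bound (hm.comp hU).aestronglyMeasurable (max B |c o|)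
      (Filter.Eventually.of_forall fun ω => ?_)
    simp only [Real.norm_eq_abs]
    split_ifs
    · exact (hB _).trans (le_max_left _ _)
    · exact le_max_right _ _
  · rw [integral_comp_ite_uniform hU hmap hp (hg o)]
    rcases o with _ | q
    · simp only [g, c, Option.elim, intervalIntegral.integral_const, smul_eq_mul, sub_zero, ← hsp]
      field_simp
      ring
    · simp [g, c, hmean]
  · have h1 : ∀ ω, (if U ω < p then g o (U ω) else c o) * (if U ω < p then g o' (U ω) else c o') =
        if U ω < p then g o (U ω) * g o' (U ω) else c o * c o' := by
      intro ω
      split_ifs <;> rfl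
    simp only [h1]
    rw [integral_comp_ite_uniform hU hmap hp (g := fun x => g o x * g o' x) ((hg o).mul (hg o'))]
    rcases o with _ | q <;> rcases o' with _ | q'
    · simp only [g, c, Option.elim, intervalIntegral.integral_const, smul_eq_mul, sub_zero,
        if_true]
      have h2 : (1 - p) * (-s⁻¹ * -s⁻¹) = p := by
        rw [← hsp]
        field_simp
      rw [h2]
      linarith
    · simp [g, c, hmean]
    · simp [g, c, hmean]
    · have h2 : ∀ x, g (some q) x * g (some q') x = 2 / p *
          (Real.cos (2 * Real.pi * (j q + 1) / p * x) *
            Real.cos (2 * Real.pi * (j q' + 1) / p * x)) := by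
        intro x
        rw [← hw]
        simp only [g, Option.elim]
        ring
      simp only [h2, intervalIntegral.integral_const_mul, integral_cos_mul_cos hp0, hj, c,
        Option.elim, Option.some.injEq, mul_zero, add_zero]
      split_ifs
      · field_simp
      · rw [mul_zero]
  · have h1 : μ {ω | U ω < p} = ENNReal.ofReal p := by
      change μ (U ⁻¹' Set.Iio p) = _
      rw [← Measure.map_apply hU measurableSet_Iio, hmap,
        Measure.restrict_apply measurableSet_Iio]
      have h2 : Set.Iio p ∩ Set.Icc 0 1 = Set.Ico 0 p := by
        ext x
        simp only [Set.mem_inter_iff, Set.mem_Iio, Set.mem_Icc, Set.mem_Ico]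
        constructor
        · exact fun h => ⟨h.2.1, h.1⟩
        · exact fun h => ⟨h.2, h.1, h.2.le.trans hp1.le⟩
      rw [h2, Real.volume_Ico, sub_zero]
    rw [measureReal_def, h1, ENNReal.toReal_ofReal hp0.le]

/-- Any family of reals is matched by uncorrelated standardized variables whose combination is
extremal for Cantelli's inequality. -/
theorem exists_standardized
    (hΩ : ∃ V : Ω → ℝ, Measurable V ∧ μ.map V = volume.restrict (Set.Icc (0 : ℝ) 1))
    [IsProbabilityMeasure μ] {p : ℝ} (hp : p ∈ Set.Ioo (0 : ℝ) 1) {ι : Type*} [Fintype ι]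
    [DecidableEq ι] (c : ι → ℝ) :
    ∃ (ξ : ι → Ω → ℝ) (A : Set Ω), (∀ q, MemLp (ξ q) 2 μ) ∧ (∀ q, ∫ ω, ξ q ω ∂μ = 0) ∧
      (∀ q q', ∫ ω, ξ q ω * ξ q' ω ∂μ = if q = q' then 1 else 0) ∧ μ.real A = p ∧
      ∀ ω ∈ A, ∑ q, c q * ξ q ω = sigma p * Real.sqrt (∑ q, c q ^ 2) := by
  obtain ⟨b, A, hb, hb0, hb1, hA, hbA⟩ := exists_noise hΩ hp ι
  set v := ∑ q, c q ^ 2 with hv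
  have hv0 : 0 ≤ v := Finset.sum_nonneg fun q _ => sq_nonneg _
  set e : ι → ℝ := fun q => c q / Real.sqrt v with he
  have hc : ∀ q, c q = Real.sqrt v * e q := by
    intro q
    rcases eq_or_ne (Real.sqrt v) 0 with h | h
    · have h1 : v = 0 := (Real.sqrt_eq_zero hv0).1 h
      have h2 := (Finset.sum_eq_zero_iff_of_nonneg fun q _ => sq_nonneg (c q)).1 h1 q
        (Finset.mem_univ q)
      simpa [h] using h2
    · simp only [he]
      field_simp
  set s := ∑ q, e q * e q with hs
  -- Either `c ≠ 0` and `e` is a unit vector, or `c = 0` and `e = 0` by division by zero; these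
  -- identities hold in both cases.
  have hes : Real.sqrt v * s = Real.sqrt v ∧ ∀ q, e q * s = e q := by
    rcases eq_or_ne (Real.sqrt v) 0 with h | h
    · simp [h, he]
    · have h1 : s = 1 := by
        have h2 : Real.sqrt v ^ 2 * s = v := by
          rw [hv, hs, Finset.mul_sum]
          refine Finset.sum_congr rfl fun q _ => ?_
          conv_rhs => rw [hc q]
          ring
        rw [Real.sq_sqrt hv0] at h2
        have h3 : v ≠ 0 := fun h3 => h (by rw [h3, Real.sqrt_zero])
        exact mul_left_cancel₀ h3 (by rw [h2, mul_one])
      simp [h1]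
  -- The matrix `[e | I - e eᵀ]` has orthonormal rows, and `cᵀ C` is supported on the column `none`.
  -- The extra noise variable avoids completing `e` to an orthonormal basis.
  let C : ι → Option ι → ℝ := fun q o =>
    o.elim (e q) fun q' => (if q = q' then 1 else 0) - e q * e q'
  have hC : ∀ q q', ∑ o, C q o * C q' o = if q = q' then 1 else 0 := by
    intro q q'
    have h1 : ∀ r, ((if q = r then (1 : ℝ) else 0) - e q * e r) *
        ((if q' = r then 1 else 0) - e q' * e r) =
        (if q = r then (if q' = r then 1 else 0) else 0) - (if q = r then e q' * e r else 0) -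
          (if q' = r then e q * e r else 0) + e q' * e q * (e r * e r) := by
      intro r
      split_ifs <;> ring
    rw [Fintype.sum_option]
    simp only [C, Option.elim]
    rw [Finset.sum_congr rfl fun r _ => h1 r, Finset.sum_add_distrib, Finset.sum_sub_distrib,
      Finset.sum_sub_distrib, ← Finset.mul_sum, ← hs, mul_assoc, hes.2]
    simp only [Finset.sum_ite_eq, Finset.mem_univ, if_true, eq_comm (a := q') (b := q)]
    ring
  refine ⟨fun q ω => ∑ o, C q o * b o ω, A, fun q => ?_, fun q => ?_, fun q q' => ?_, hA,
    fun ω hω => ?_⟩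
  · exact memLp_finsetSum _ fun o _ => (hb o).const_mul _
  · rw [integral_finsetSum _ fun o _ => ((hb o).integrable one_le_two).const_mul _]
    simp [integral_const_mul, hb0]
  · have hi : ∀ o o', Integrable (fun ω => C q o * C q' o' * (b o ω * b o' ω)) μ :=
      fun o o' => ((hb o).integrable_mul (hb o')).const_mul _
    have h1 : ∀ ω, (∑ o, C q o * b o ω) * (∑ o, C q' o * b o ω) =
        ∑ o, ∑ o', C q o * C q' o' * (b o ω * b o' ω) := by
      intro ω
      rw [Finset.sum_mul_sum]
      refine Finset.sum_congr rfl fun o _ => Finset.sum_congr rfl fun o' _ => ?_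
      ring
    simp only [h1]
    rw [integral_finsetSum _ fun o _ => integrable_finsetSum _ fun o' _ => hi o o', ← hC]
    refine Finset.sum_congr rfl fun o _ => ?_
    rw [integral_finsetSum _ fun o' _ => hi o o']
    simp [integral_const_mul, hb1]
  · have h1 : ∀ o, ∑ q, c q * C q o = o.elim (Real.sqrt v) fun _ => 0 := by
      rintro (_ | r)
      · simp only [C, Option.elim]
        rw [← hes.1, hs, Finset.mul_sum]
        refine Finset.sum_congr rfl fun q _ => ?_
        rw [hc q, mul_assoc]
      · simp only [C, Option.elim, mul_sub, Finset.sum_sub_distrib, mul_ite, mul_one, mul_zero,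
          Finset.sum_ite_eq', Finset.mem_univ, if_true]
        have h2 : ∑ q, c q * (e q * e r) = Real.sqrt v * s * e r := by
          rw [hs, Finset.mul_sum, Finset.sum_mul]
          refine Finset.sum_congr rfl fun q _ => ?_
          rw [hc q]
          ring
        rw [h2, hes.1, ← hc r, sub_self]
    simp only [Finset.mul_sum]
    rw [Finset.sum_comm]
    simp only [← mul_assoc, ← Finset.sum_mul, h1]
    rw [Fintype.sum_option]
    simp [hbA ω hω, mul_comm]

end Noise

/-! ### Robust chance constraints -/

section Robust

variable {Ω : Type*} [MeasurableSpace Ω] {μ : Measure Ω} [IsProbabilityMeasure μ] {N n : ℕ}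

theorem exists_hasMoments_extremal
    (hΩ : ∃ V : Ω → ℝ, Measurable V ∧ μ.map V = volume.restrict (Set.Icc (0 : ℝ) 1))
    {p : ℝ} (hp : p ∈ Set.Ioo (0 : ℝ) 1) (m : Fin n → ℝ) (V : Matrix (Fin n) (Fin n) ℝ)
    (f : (Fin N → Fin n → ℝ) →ₗ[ℝ] ℝ) :
    ∃ (W : Fin N → Ω → Fin n → ℝ) (A : Set Ω), HasMoments μ W m V ∧ μ.real A = p ∧
      ∀ ω ∈ A, f (W · ω) = f (coeffSeq N m V (.inl ())) +
        sigma p * Real.sqrt (∑ q, f (coeffSeq N m V (.inr q)) ^ 2) := by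
  obtain ⟨ξ, A, hξ, hξ0, hξ1, hA, hξA⟩ :=
    exists_standardized hΩ hp fun q => f (coeffSeq N m V (.inr q))
  have hcov : ∀ q q', cov[ξ q, ξ q'; μ] = if q = q' then 1 else 0 := by
    intro q q'
    rw [covariance_eq_sub (hξ q) (hξ q'), hξ0, hξ0, ← hξ1]
    simp
  have hL : ∀ k a, MemLp (fun ω => ∑ b, V a b * ξ (k, b) ω) 2 μ := fun k a =>
    memLp_finsetSum _ fun b _ => (hξ (k, b)).const_mul _
  -- The disturbance `W k = m + V ξ_k`, with `ξ` adapted to the values of `f` on the columns of `I ⊗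
  -- V`.
  refine ⟨fun k ω a => m a + ∑ b, V a b * ξ (k, b) ω, A, ⟨fun k => ?_, fun k a => ?_,
    fun k i a b => ?_⟩, hA, fun ω hω => ?_⟩
  · refine memLp_pi_iff.2 fun a => ?_
    have h : MemLp (fun ω => m a + ∑ b, V a b * ξ (k, b) ω) 2 μ :=
      (memLp_const (m a)).add (hL k a)
    exact h
  · rw [integral_add (integrable_const _) ((hL k a).integrable one_le_two),
      integral_finsetSum _ fun b _ => ((hξ (k, b)).integrable one_le_two).const_mul _]
    simp [integral_const_mul, hξ0]
  · rw [covariance_const_add_left ((hL k a).integrable one_le_two),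
      covariance_const_add_right ((hL i b).integrable one_le_two),
      covariance_fun_sum_fun_sum (X := fun c ω => V a c * ξ (k, c) ω)
        (Y := fun c ω => V b c * ξ (i, c) ω) (fun c => (hξ _).const_mul _)
        (fun c => (hξ _).const_mul _)]
    simp only [covariance_const_mul_left, covariance_const_mul_right, hcov, Prod.mk.injEq]
    split_ifs with hk
    · simp [hk, Matrix.mul_apply, mul_comm]
    · simp [hk]
  · rw [← hξA ω hω]
    have h : (fun k a => m a + ∑ b, V a b * ξ (k, b) ω) = coeffSeq N m V (.inl ()) +
        ∑ q, ξ q ω • coeffSeq N m V (.inr q) := by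
      ext k a
      simp only [coeffSeq, Sum.elim_inl, Sum.elim_inr, Pi.add_apply, Finset.sum_apply,
        Pi.smul_apply, smul_eq_mul, Fintype.sum_prod_type]
      rw [Finset.sum_eq_single k]
      · simp [mul_comm]
      · intro i _ hi
        simp [hi.symm]
      · simp
    rw [h, map_add, map_sum]
    simp [mul_comm]

/-- Cantelli's bound is sharp over all disturbances with the given moments. If the cone inequality
fails, it still fails with a risk level `p` slightly above `ε`, and the extremal disturbance for `p`
violates the constraint with probability at least `p`. -/
theorem chance_constraint_iff
    (hΩ : ∃ V : Ω → ℝ, Measurable V ∧ μ.map V = volume.restrict (Set.Icc (0 : ℝ) 1))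
    {ε : ℝ} (hε : ε ∈ Set.Ioo (0 : ℝ) 1) (m : Fin n → ℝ) (V : Matrix (Fin n) (Fin n) ℝ)
    (c : ℝ) (f : (Fin N → Fin n → ℝ) →ₗ[ℝ] ℝ) :
    (∀ W, HasMoments μ W m V → 1 - ε ≤ μ.real {ω | c + f (W · ω) ≤ 1}) ↔
      c + f (coeffSeq N m V (.inl ())) +
        sigma ε * Real.sqrt (∑ q, f (coeffSeq N m V (.inr q)) ^ 2) ≤ 1 := by
  constructor
  · intro h
    by_contra! hgt
    have hcont : ContinuousAt (fun p => c + f (coeffSeq N m V (.inl ())) +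
        sigma p * Real.sqrt (∑ q, f (coeffSeq N m V (.inr q)) ^ 2)) ε := by
      unfold sigma
      have := hε.1.ne'
      fun_prop (disch := assumption)
    have h1 : ∀ᶠ p in nhdsWithin ε (Set.Ioi ε), 1 < c + f (coeffSeq N m V (.inl ())) +
        sigma p * Real.sqrt (∑ q, f (coeffSeq N m V (.inr q)) ^ 2) :=
      (hcont.eventually (lt_mem_nhds hgt)).filter_mono nhdsWithin_le_nhds
    -- Taking `p = ε` would not suffice: a violation of probability exactly `ε` is permitted.
    obtain ⟨p, hp1, hp⟩ := (h1.and (Ioo_mem_nhdsGT hε.2)).exists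
    obtain ⟨W, A, hW, hA, hWA⟩ := exists_hasMoments_extremal hΩ
      ⟨hε.1.trans hp.1, hp.2⟩ m V f
    have h2 : {ω | c + f (W · ω) ≤ 1} ∩ A = ∅ := by
      ext ω
      simp only [Set.mem_inter_iff, Set.mem_ofPred_eq, Set.mem_empty_iff_false, iff_false, not_and]
      intro h3 h4
      rw [hWA ω h4] at h3
      linarith
    -- Additivity rests on null measurability of this set, since `A` is not known to be measurable.
    have hnull : NullMeasurableSet {ω | c + f (W · ω) ≤ 1} μ :=
      nullMeasurableSet_le (hW.memLp_affine c f).aestronglyMeasurable.aemeasurable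
        aemeasurable_const
    have h3 : μ.real ({ω | c + f (W · ω) ≤ 1} ∪ A) = μ.real {ω | c + f (W · ω) ≤ 1} + μ.real A := by
      have h4 := measureReal_union_add_inter₀' (t := A) hnull
      rw [h2, measureReal_empty, add_zero] at h4
      exact h4
    have h4 : μ.real ({ω | c + f (W · ω) ≤ 1} ∪ A) ≤ 1 := measureReal_le_one
    have h5 := h W hW
    have h6 := hp.1
    linarith
  · intro h W hW
    refine one_sub_le_measureReal_le_one (hW.memLp_affine c f) hε ?_
    rw [hW.integral_affine, hW.cov_affine]
    simpa only [sq] using h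

/-- The functional `x ↦ a ⬝ᵥ x`. -/
def dotLinear {ι : Type} [Fintype ι] (a : ι → ℝ) : (ι → ℝ) →ₗ[ℝ] ℝ where
  toFun x := a ⬝ᵥ x
  map_add' := dotProduct_add a
  map_smul' r x := dotProduct_smul r a x

theorem dotProduct_chance_constraint_iff
    (hΩ : ∃ V : Ω → ℝ, Measurable V ∧ μ.map V = volume.restrict (Set.Icc (0 : ℝ) 1))
    {ε : ℝ} (hε : ε ∈ Set.Ioo (0 : ℝ) 1) (m : Fin n → ℝ) (V : Matrix (Fin n) (Fin n) ℝ)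
    {ι : Type} [Fintype ι] (a c : ι → ℝ) (f : (Fin N → Fin n → ℝ) →ₗ[ℝ] (ι → ℝ)) :
    (∀ W, HasMoments μ W m V → 1 - ε ≤ μ.real {ω | a ⬝ᵥ (c + f (W · ω)) ≤ 1}) ↔
      a ⬝ᵥ (c + f (coeffSeq N m V (.inl ()))) +
        sigma ε * Real.sqrt (∑ q, (a ⬝ᵥ f (coeffSeq N m V (.inr q))) ^ 2) ≤ 1 := by
  simp only [dotProduct_add]
  exact chance_constraint_iff hΩ hε m V (a ⬝ᵥ c) (dotLinear a ∘ₗ f)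

variable {nu ny nw Nu Ny : ℕ}

theorem HasMoments.sum_integral_quad {W : Fin N → Ω → Fin nw → ℝ} {m : Fin nw → ℝ}
    {V : Matrix (Fin nw) (Fin nw) ℝ} (h : HasMoments μ W m V) (P : OCPData nu ny nw Nu Ny)
    (r : Response N nu ny nw) :
    ∑ k, ∫ ω, (quad P.Q (r.y₀ k + r.yLin k (W · ω)) +
      quad P.R (r.u₀ k + r.uLin k (W · ω))) ∂μ =
    ∑ k, ((quad P.Q (r.y₀ k + r.yLin k (coeffSeq N m V (.inl ()))) +
        quad P.R (r.u₀ k + r.uLin k (coeffSeq N m V (.inl ())))) +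
      ∑ q, (quad P.Q (r.yLin k (coeffSeq N m V (.inr q))) +
        quad P.R (r.uLin k (coeffSeq N m V (.inr q))))) := by
  refine Finset.sum_congr rfl fun k _ => ?_
  rw [integral_add (h.integrable_quad _ _ _) (h.integrable_quad _ _ _), h.integral_quad,
    h.integral_quad, Finset.sum_add_distrib]
  ring

/-- The constraints hold for all disturbances with given moments if and only if they hold for the
coefficients. -/
theorem forall_stochasticConstraints_iff
    (hΩ : ∃ V : Ω → ℝ, Measurable V ∧ μ.map V = volume.restrict (Set.Icc (0 : ℝ) 1))
    {P : OCPData nu ny nw Nu Ny} (hεu : P.εu ∈ Set.Ioo (0 : ℝ) 1)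
    (hεy : P.εy ∈ Set.Ioo (0 : ℝ) 1) (m : Fin nw → ℝ) (V : Matrix (Fin nw) (Fin nw) ℝ)
    (r : Response N nu ny nw) (α : ℝ) :
    (∀ W, HasMoments μ W m V → StochasticConstraints μ P r α W) ↔
      CoefficientConstraints P r α (coeffSeq N m V) := by
  constructor
  · intro h
    -- The cost needs just one disturbance with these moments; the zero functional and the level
    -- `εu` are arbitrary choices. Each chance constraint below is tested against its own extremal
    -- disturbance.
    obtain ⟨W, -, hW, -⟩ := exists_hasMoments_extremal hΩ hεu m V
      (0 : (Fin N → Fin nw → ℝ) →ₗ[ℝ] ℝ)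
    refine ⟨?_, fun k i => ?_, fun k i => ?_⟩
    · rw [← hW.sum_integral_quad]
      exact (h W hW).1
    · exact (dotProduct_chance_constraint_iff hΩ hεu m V _ _ _).1 fun W hW => (h W hW).2.1 k i
    · exact (dotProduct_chance_constraint_iff hΩ hεy m V _ _ _).1 fun W hW => (h W hW).2.2 k i
  · rintro ⟨h1, h2, h3⟩ W hW
    refine ⟨?_, fun k i => ?_, fun k i => ?_⟩
    · rw [hW.sum_integral_quad]
      exact h1
    · exact (dotProduct_chance_constraint_iff hΩ hεu m V _ _ _).2 (h2 k i) W hW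
    · exact (dotProduct_chance_constraint_iff hΩ hεy m V _ _ _).2 (h3 k i) W hW

/-- The uncertainty set is the union over `𝔸` of the classes of disturbances with moments `(m, V
Vᵀ)`, so the robust constraints split into one equivalence per class. -/
theorem forall_uncertaintySet_iff
    (hΩ : ∃ V : Ω → ℝ, Measurable V ∧ μ.map V = volume.restrict (Set.Icc (0 : ℝ) 1))
    {P : OCPData nu ny nw Nu Ny} (hΓ : P.Γbar.PosDef) (hρ : 0 ≤ P.ρ)
    (hεu : P.εu ∈ Set.Ioo (0 : ℝ) 1) (hεy : P.εy ∈ Set.Ioo (0 : ℝ) 1)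
    (r : Response N nu ny nw) (α : ℝ) :
    (∀ W ∈ uncertaintySet μ N P.mbar P.Γbar P.ρ, StochasticConstraints μ P r α W) ↔
      ∀ Wf ∈ coeffUncertaintySet N P.mbar P.Γbar P.ρ,
        CoefficientConstraints P r α fun j => block (Wf.col j) := by
  constructor
  · rintro h _ ⟨M, hM, rfl⟩
    rw [block_col_eq_coeffSeq, ← forall_stochasticConstraints_iff hΩ hεu hεy]
    exact fun W hW => h W (hW.mem_uncertaintySet hΓ.posSemidef hM)
  · intro h W hW
    obtain ⟨M, hM, hWM⟩ := exists_hasMoments_of_mem_uncertaintySet hΓ hρ hW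
    have h1 := h _ ⟨M, hM, rfl⟩
    rw [block_col_eq_coeffSeq, ← forall_stochasticConstraints_iff hΩ hεu hεy] at h1
    exact h1 W hWM

end Robust

end DROCP

end

/-! ### Equality of the two sets of minimizers -/

theorem theorem1 {nx nu ny nw Nu Ny N T Tini : ℕ}
    {Ω : Type*} [MeasurableSpace Ω] (μ : Measure Ω) [IsProbabilityMeasure μ]
    -- the probability space carries a uniformly distributed random variable
    (hΩ : ∃ V : Ω → ℝ, Measurable V ∧ μ.map V = volume.restrict (Set.Icc (0 : ℝ) 1))
    (S : DROCP.LTISystem nx nu ny nw) (P : DROCP.OCPData nu ny nw Nu Ny)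
    (hQ : P.Q.PosSemidef) (hR : P.R.PosDef) (hΓ : P.Γbar.PosDef) (hρ : 0 ≤ P.ρ)
    (hεu : P.εu ∈ Set.Ioo (0 : ℝ) 1) (hεy : P.εy ∈ Set.Ioo (0 : ℝ) 1)
    (hcontr : S.Controllable) (hobs : S.Observable)
    -- recorded data
    (ud : Fin T → Fin nu → ℝ) (wd : Fin T → Fin nw → ℝ) (yd : Fin T → Fin ny → ℝ)
    (hdata : S.IsTrajectory ud wd yd)
    (hpe : DROCP.PersistentlyExciting (nx + N + Tini) fun k => Sum.elim (ud k) (wd k))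
    (hlag : S.lag ≤ Tini)
    -- initial data
    (up : Fin Tini → Fin nu → ℝ) (yp : Fin Tini → Fin ny → ℝ) (wp : Fin Tini → Fin nw → ℝ)
    (hini : S.IsTrajectory up wp yp) :
    ∃ xini : Fin nx → ℝ,
      DROCP.minimizers (DROCP.modelFeasible μ S P N xini) =
        DROCP.minimizers (DROCP.dataFeasible ud wd yd up yp wp P N) := by
  obtain ⟨x, hx⟩ := hini
  have hpast : S.Steers (x 0) (x Tini) up wp yp := ⟨x, rfl, rfl, hx⟩
  -- The initial state is the one in which the past trajectory ends; minimizers agree because the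
  -- feasible sets do.
  refine ⟨x Tini, congrArg DROCP.minimizers (Set.ext fun z => ?_)⟩
  rw [DROCP.mem_modelFeasible_iff,
    DROCP.mem_dataFeasible_iff hcontr hobs hlag hdata hpe hpast,
    DROCP.forall_uncertaintySet_iff hΩ hΓ hρ hεu hεy]
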